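/- Let $K=2$ and $N\in\{2,3\}$. Consider the two-user device-to-device private caching system with a trusted server. The library consists of $N$ files $F_1,\dots,F_N$ of $B$ independent uniform bits each. The demand vector $\mathbf D=(D_1,D_2)\in\{1,\dots,N\}^2$ has a fixed law under which every demand vector has positive probability. User $k$ has the cache $Z_k=(\mathcal M(C_k),C_k)$, where the metadata $\mathcal M(C_k)$ is chosen, possibly at random, without knowledge of the demands, and the content $C_k$ is a function of the library and of $\mathcal M(C_k)$. From the demands and the metadata of the caches (and randomness of its own) the server, which has no access to the library, sends metadata $\mathcal M(P_k)$ to user $k$, describing how a payload $P_k$ is composed from the library. User $k$ then broadcasts $X_k=(\mathcal M(P_k),P_k)$. The library, the demands and the randomness of the placement and of the server are independent. Write $\mathbf X=(X_1,X_2)$. The load $R$ is achievable at cache size $M$ if there are $\epsilon_B\ge 0$ with $\epsilon_B\to 0$ such that for every sufficiently large $B$ some scheme satisfies, for $k=1,2$ (entropies in bits), $$H(Z_k)\le B(M+\epsilon_B),\quad H(X_k\mid \mathcal M(P_k),Z_k)=0,\quad H(F_{D_k}\mid \mathbf X,Z_k,D_k)\le B\epsilon_B,\quad I(\mathbf D;\mathbf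 X,Z_k\mid D_k)=0,$$ and $H(X_1)+H(X_2)\le B(R+\epsilon_B)$. The placement is uncoded if each user directly copies some of the bits of the files into its cache; $R^\star_{\mathrm u}(M)$ denotes the minimum load achievable with uncoded placement. Scheme B consists of the following schemes. For $t\in\{0,\dots,N-1\}$, each file is divided into two halves, one for each user, and each half into $\binom{N-1}{t}+\binom{N-2}{t-1}$ equal subfiles (with $\binom{N-2}{-1}=0$), which are permuted uniformly at random, independently for all halves. Each user caches its own half of each file and the first $\binom{N-2}{t-1}$ permuted subfiles of the other half. For each set $S$ of $t+1$ files, each user sends the sum modulo $2$ of one subfile of its own half of each file $i\in S$. No subfile is used twice, and, when the other user demands file $d$, the subfile of file $i$ is one that the other user caches if and only if $d\in S$ and $i\ne d$. Moreover, Scheme B includes the trivial scheme in which both users cache the whole library and nothing is sent, and memory-sharing between all these schemes. Let $R_{\mathrm B}(M)$ be the lower convex envelope of the points $(N,0)$ and $$\left(\frac N2+\frac{Nt}{2(N+t-1)},\ \frac{N(N-1)}{(t+1)(N+t-1)}\right),\qquad t\in\{0,1,\dots,N-1\}.$$ Then, for every memory size $M\in[N/2,N]$, Scheme B is exactly optimal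 under uncoded cache placement: the minimum load achievable at cache size $M$ by Scheme B is $R_{\mathrm B}(M)$, and it equals the minimum load achievable with uncoded placement, that is, $R^\star_{\mathrm u}(M)=R_{\mathrm B}(M)$. -/

import Mathlib

open Filter Topology

noncomputable section

/-! ## Shannon entropies (in bits) of finite-valued random variables -/

/-- Shannon entropy `H(X)`, in bits, of a random variable with values in a finite type. -/
def entropy {Ω α : Type} [Fintype α] (P : PMF Ω) (X : Ω → α) : ℝ :=
  (∑ x, Real.negMulLog ((P.map X) x).toReal) / Real.log 2

/-- Conditional entropy `H(X | Y) = H(X, Y) - H(Y)`. -/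
def condEntropy {Ω α β : Type} [Fintype α] [Fintype β] (P : PMF Ω)
    (X : Ω → α) (Y : Ω → β) : ℝ :=
  entropy P (fun ω => (X ω, Y ω)) - entropy P Y

/-- Conditional mutual information `I(X; Y | Z) = H(X | Z) - H(X | Y, Z)`. -/
def condMutualInfo {Ω α β γ : Type} [Fintype α] [Fintype β] [Fintype γ] (P : PMF Ω)
    (X : Ω → α) (Y : Ω → β) (Z : Ω → γ) : ℝ :=
  condEntropy P X Z - condEntropy P X (fun ω => (Y ω, Z ω))

/-! ## The device-to-device private caching system with a trusted server -/

/-- A library of `N` files of `B` bits each. -/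
abbrev Library (N B : ℕ) : Type := Fin N → Fin B → ZMod 2

/-- The demands of the `K` users. -/
abbrev Demands (K N : ℕ) : Type := Fin K → Fin N

/-- A caching scheme for `K` users and `N` files of `B` bits. The whole randomness of the
placement and of the trusted server is in the `Seed`, which is independent of the library and of
the demands. The metadata and the contents of the users take their values in common finite
alphabets. -/
structure CachingScheme (K N B : ℕ) : Type 1 where
  /-- randomness of the placement and of the server -/
  Seed : Type
  /-- alphabet of the metadata of the cached contents -/
  CacheMeta : Type
  /-- alphabet of the cached contents -/
  Content : Type
  /-- alphabet of the metadata of the transmitted packets -/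
  TxMeta : Type
  /-- alphabet of the transmitted packets -/
  Payload : Type
  [fintypeSeed : Fintype Seed]
  [fintypeCacheMeta : Fintype CacheMeta]
  [fintypeContent : Fintype Content]
  [fintypeTxMeta : Fintype TxMeta]
  [fintypePayload : Fintype Payload]
  /-- the law of the seed -/
  seedLaw : PMF Seed
  /-- the metadata of the cache of each user, chosen without knowledge of the demands -/
  cacheMeta : Seed → Fin K → CacheMeta
  /-- the cached content of each user, a function of its metadata and of the library -/
  content : Fin K → CacheMeta → Library N B → Content
  /-- the metadata that the server, which has no access to the library, sends to each user -/
  txMeta : Seed → Demands K N → Fin K → TxMeta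
  /-- the packets of each user, whose composition is described by the metadata from the server -/
  payload : Fin K → TxMeta → Library N B → Payload

namespace CachingScheme

attribute [instance] fintypeSeed fintypeCacheMeta fintypeContent fintypeTxMeta fintypePayload

variable {K N B : ℕ} (s : CachingScheme K N B)

/-- The sample space: library, demands and seed. -/
abbrev Sample : Type := Library N B × Demands K N × s.Seed

/-- The joint law: the bits of the library are independent and uniform, the demands have the given
law, and library, demands and seed are independent. -/
def law (demandLaw : PMF (Demands K N)) : PMF s.Sample :=
  (PMF.uniformOfFintype (Library N B)).bind fun F =>
    demandLaw.bind fun d => s.seedLaw.map fun w => (F, d, w)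

/-- The demand vector `D`. -/
def demands (ω : s.Sample) : Demands K N := ω.2.1

/-- The demand `D_k`. -/
def demand (k : Fin K) (ω : s.Sample) : Fin N := ω.2.1 k

/-- The file `F_{D_k}` demanded by user `k`. -/
def demandedFile (k : Fin K) (ω : s.Sample) : Fin B → ZMod 2 := ω.1 (ω.2.1 k)

/-- The cache `Z_k`: metadata and content. -/
def cache (k : Fin K) (ω : s.Sample) : s.CacheMeta × s.Content :=
  (s.cacheMeta ω.2.2 k, s.content k (s.cacheMeta ω.2.2 k) ω.1)

/-- The metadata of the packets of user `k`. -/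
def packetMeta (k : Fin K) (ω : s.Sample) : s.TxMeta := s.txMeta ω.2.2 ω.2.1 k

/-- The signal `X_k` broadcast by user `k`: metadata and packets. -/
def signal (k : Fin K) (ω : s.Sample) : s.TxMeta × s.Payload :=
  (s.packetMeta k ω, s.payload k (s.packetMeta k ω) ω.1)

/-- All the signals `X`. -/
def signals (ω : s.Sample) : Fin K → s.TxMeta × s.Payload := fun k => s.signal k ω

/-- The constraints on a scheme for cache size `M` and load `R`, with slack `ε`. -/
structure IsValid (demandLaw : PMF (Demands K N)) (M R ε : ℝ) : Prop where
  /-- cache size constraint -/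
  memory : ∀ k, entropy (s.law demandLaw) (s.cache k) ≤ B * (M + ε)
  /-- encoding constraint: a user sends a function of its cache and of the server's metadata -/
  encoding : ∀ k, condEntropy (s.law demandLaw) (s.signal k)
    (fun ω => (s.packetMeta k ω, s.cache k ω)) = 0
  /-- decoding constraint -/
  decoding : ∀ k, condEntropy (s.law demandLaw) (s.demandedFile k)
    (fun ω => (s.signals ω, s.cache k ω, s.demand k ω)) ≤ B * ε
  /-- privacy constraint -/
  privacy : ∀ k, condMutualInfo (s.law demandLaw) s.demands
    (fun ω => (s.signals ω, s.cache k ω)) (s.demand k) = 0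
  /-- load -/
  load : ∑ k, entropy (s.law demandLaw) (s.signal k) ≤ B * (R + ε)

/-- Uncoded cache placement: each user copies some of the bits of the library, that is, what is
cached under given metadata amounts to the bits at certain positions. -/
def IsUncoded : Prop :=
  ∀ (k : Fin K) (m : s.CacheMeta), ∃ S : Set (Fin N × Fin B), ∀ F F' : Library N B,
    s.content k m F = s.content k m F' ↔ ∀ x ∈ S, F x.1 x.2 = F' x.1 x.2

end CachingScheme

/-- The load `R` is achievable at cache size `M` by schemes of the class `𝒮`: there are slacks
`ε_B ≥ 0` that tend to `0` such that, for all large file sizes `B`, a scheme of the class meets all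
the constraints. -/
def Achievable {K N : ℕ} (𝒮 : ∀ B : ℕ, CachingScheme K N B → Prop)
    (demandLaw : PMF (Demands K N)) (M R : ℝ) : Prop :=
  ∃ ε : ℕ → ℝ, (∀ B, 0 ≤ ε B) ∧ Tendsto ε atTop (𝓝 0) ∧
    ∀ᶠ B : ℕ in atTop, ∃ s : CachingScheme K N B, 𝒮 B s ∧ s.IsValid demandLaw M R (ε B)

/-- The class of the schemes with uncoded cache placement. -/
def UncodedPlacement (K N : ℕ) (B : ℕ) (s : CachingScheme K N B) : Prop := s.IsUncoded

/-! ## Scheme B -/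

namespace SchemeB

/-- `C(N-2, t-1)`, which is `0` for `t = 0`: the number of subfiles of a half-file that are cached
by the user that is not in charge of this half. -/
def sharedCount (N : ℕ) : ℕ → ℕ
  | 0 => 0
  | t + 1 => (N - 2).choose t

/-- `C(N-1, t) + C(N-2, t-1)`: the number of subfiles of a half-file. -/
def subfileCount (N t : ℕ) : ℕ := sharedCount N t + (N - 1).choose t

/-- The sets of `t + 1` files; one message is sent for each of them by each user. -/
abbrev Group (N t : ℕ) : Type := {S : Finset (Fin N) // S.card = t + 1}

/-- The position, in a file, of bit `b` of subfile `j` of the half-file of user `k`. -/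
def position {U ℓ : ℕ} (k : Fin 2) (j : Fin U) (b : Fin ℓ) : Fin (2 * (U * ℓ)) :=
  finProdFinEquiv (k, finProdFinEquiv (j, b))

/-- A rule that picks the subfiles for the messages of a user, when the other user demands `d`:
`pick d S i` is the rank, in the permuted list of subfiles, of the subfile of file `i ∈ S` in the
message of `S`. No subfile is picked twice. The other user caches the subfiles of rank less than
`sharedCount N t`; such a subfile is picked exactly when `d ∈ S` and `i ≠ d`. -/
structure IsPickRule (N t : ℕ)
    (pick : Fin N → (S : Group N t) → {i // i ∈ S.1} → Fin (subfileCount N t)) : Prop where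
  injective : ∀ (d i : Fin N) (S S' : Group N t) (h : i ∈ S.1) (h' : i ∈ S'.1),
    pick d S ⟨i, h⟩ = pick d S' ⟨i, h'⟩ → S = S'
  shared_iff : ∀ (d : Fin N) (S : Group N t) (i : {i // i ∈ S.1}),
    (pick d S i : ℕ) < sharedCount N t ↔ d ∈ S.1 ∧ i.1 ≠ d

/-- The scheme for one corner point, with subfiles of `ℓ` bits. For each user `k` and file `i`, a
uniform permutation `w k i` of the subfiles of the half-file of user `k` is drawn. User `k` caches
its half of each file, and the first `sharedCount N t` permuted subfiles of the other half. It
sends, for each set `S` of `t + 1` files, the sum modulo 2 of the picked subfiles of these files,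
taken from its half. -/
def corner (N t ℓ : ℕ)
    (pick : Fin N → (S : Group N t) → {i // i ∈ S.1} → Fin (subfileCount N t)) :
    CachingScheme 2 N (2 * (subfileCount N t * ℓ)) where
  Seed := Fin 2 → Fin N → Equiv.Perm (Fin (subfileCount N t))
  CacheMeta := Fin N → Fin (sharedCount N t) → Fin (subfileCount N t)
  Content := (Fin N → Fin (subfileCount N t) → Fin ℓ → ZMod 2) ×
    (Fin N → Fin (sharedCount N t) → Fin ℓ → ZMod 2)
  TxMeta := (S : Group N t) → {i // i ∈ S.1} → Fin (subfileCount N t)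
  Payload := Group N t → Fin ℓ → ZMod 2
  seedLaw := PMF.uniformOfFintype _
  cacheMeta w k := fun i j => w k.rev i (Fin.castAdd _ j)
  content k m F :=
    (fun i j b => F i (position k j b), fun i j b => F i (position k.rev (m i j) b))
  txMeta w d k := fun S i => w k i.1 (pick (d k.rev) S i)
  payload k m F := fun S b => ∑ i : {i // i ∈ S.1}, F i.1 (position k (m S i) b)

/-- The trivial scheme in which each user caches the whole library and nothing is sent. -/
def cacheAll (N B : ℕ) : CachingScheme 2 N B where
  Seed := Unit
  CacheMeta := Unit
  Content := Library N B
  TxMeta := Unit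
  Payload := Unit
  seedLaw := PMF.pure ()
  cacheMeta _ _ := ()
  content _ _ F := F
  txMeta _ _ _ := ()
  payload _ _ _ := ()

/-- Memory-sharing: each file is cut in two pieces, and a scheme is used for each piece, with
independent seeds. -/
def share {K N B₁ B₂ : ℕ} (s₁ : CachingScheme K N B₁) (s₂ : CachingScheme K N B₂) :
    CachingScheme K N (B₁ + B₂) where
  Seed := s₁.Seed × s₂.Seed
  CacheMeta := s₁.CacheMeta × s₂.CacheMeta
  Content := s₁.Content × s₂.Content
  TxMeta := s₁.TxMeta × s₂.TxMeta
  Payload := s₁.Payload × s₂.Payload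
  seedLaw := s₁.seedLaw.bind fun w₁ => s₂.seedLaw.map fun w₂ => (w₁, w₂)
  cacheMeta w k := (s₁.cacheMeta w.1 k, s₂.cacheMeta w.2 k)
  content k m F := (s₁.content k m.1 (fun i b => F i (Fin.castAdd B₂ b)),
    s₂.content k m.2 (fun i b => F i (Fin.natAdd B₁ b)))
  txMeta w d k := (s₁.txMeta w.1 d k, s₂.txMeta w.2 d k)
  payload k m F := (s₁.payload k m.1 (fun i b => F i (Fin.castAdd B₂ b)),
    s₂.payload k m.2 (fun i b => F i (Fin.natAdd B₁ b)))

/-- Scheme B for `N` files: the schemes of the corner points `t = 0, …, N - 1`, the trivial scheme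
of the corner point `(N, 0)`, and memory-sharing between them. -/
inductive IsSchemeB (N : ℕ) : ∀ B : ℕ, CachingScheme 2 N B → Prop
  | corner (t ℓ : ℕ) (ht : t < N)
      (pick : Fin N → (S : Group N t) → {i // i ∈ S.1} → Fin (subfileCount N t))
      (hpick : IsPickRule N t pick) : IsSchemeB N _ (corner N t ℓ pick)
  | cacheAll (B : ℕ) : IsSchemeB N B (cacheAll N B)
  | share {B₁ B₂ : ℕ} (s₁ : CachingScheme 2 N B₁) (s₂ : CachingScheme 2 N B₂)
      (h₁ : IsSchemeB N B₁ s₁) (h₂ : IsSchemeB N B₂ s₂) : IsSchemeB N (B₁ + B₂) (share s₁ s₂)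

/-- The corner points (cache size, load) of Scheme B. -/
def cornerPoints (N : ℕ) : Set (ℝ × ℝ) :=
  {((N : ℝ), (0 : ℝ))} ∪
    {x | ∃ t : ℕ, t < N ∧
      x = ((N : ℝ) / 2 + (N : ℝ) * t / (2 * ((N : ℝ) + t - 1)),
        (N : ℝ) * ((N : ℝ) - 1) / (((t : ℝ) + 1) * ((N : ℝ) + t - 1)))}

/-- The lower convex envelope, at `M`, of the corner points of Scheme B. -/
def load (N : ℕ) (M : ℝ) : ℝ := sInf {r : ℝ | (M, r) ∈ convexHull ℝ (cornerPoints N)}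

end SchemeB

end

/-! The converse turns privacy into virtual caches. Let both users demand `f₁`, with signals `p`,
`p'` and cached positions `A₁`, `C₁`. What user 1 sees of the metadata has the same law when user 0
demands `f₂` instead, so the same signals are compatible with a cache `A₂` of user 0 that decodes
`f₂`. By symmetry there are `C₂`, `A₃`, `C₃`. The signal `p` is a function of each `Aᵢ`, and `p'` of
each `Cⱼ`. Revealing `C₁`, file `f₁`, `C₂`, file `f₂`, ... in turn (`condEntropy_step`) gives, up to
decoding errors, H(p) ≥ |f₁ \ C₁| + |f₂ \ (C₁ ∪ C₂)| + |f₃ \ (C₁ ∪ C₂ ∪ C₃)|, and likewise for `p'`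
with the `Aᵢ`.

Two compatible caches `Aᵢ`, `Cⱼ`, one of which decodes a file, nearly cover that file, since a bit
that both miss is in no signal. Two caches of one actual placement nearly cover every file. Counting
bit by bit (`card_sdiff_two_le`, `card_sdiff_three_le`) then trades the unions for single caches. If
x_j is the mean number of bits of file j missing from the two caches, counted together, and L the
total load in bits, this yields x₁ ≤ L, x₁ + 2x₂ ≤ L + B and x₁ + 2x₂ + 3x₃ ≤ L + 3B, up to errors.
Averaging over cyclic shifts of the files and using ∑ x_j ≥ 2B(N - M) produces lines that contain
the edges of the envelope for N = 2, 3.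

For achievability, the corner schemes make no errors, and their metadata take a number of bits that
does not grow with the subfile length. They are private because uniform permutations remain uniform
after composition with a fixed one. Memory-sharing fills the convex hull (`convex_isAchieved`). As
Scheme B is uncoded, a hull point below all loads achievable with uncoded placement is the minimum
for both classes. -/

noncomputable section

/-! ## Entropies of finite-valued random variables -/

/-- The probability `P(X = x)`, as a real number. -/
def pr {Ω α : Type} (P : PMF Ω) (X : Ω → α) (x : α) : ℝ := ((P.map X) x).toReal

section Shannon

variable {Ω α β γ : Type} [Fintype Ω] [Fintype α] [Fintype β] [Fintype γ] (P : PMF Ω)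

theorem pmf_sum_toReal : ∑ ω, (P ω).toReal = 1 := by
  rw [← ENNReal.toReal_sum (fun ω _ => P.apply_ne_top ω), ← tsum_fintype (L := .unconditional _),
    P.tsum_coe, ENNReal.toReal_one]

open Classical in
theorem pr_eq_sum {α : Type} (X : Ω → α) (x : α) :
    pr P X x = ∑ ω, if x = X ω then (P ω).toReal else 0 := by
  rw [pr, PMF.map_apply, tsum_fintype, ENNReal.toReal_sum]
  · refine Finset.sum_congr rfl fun ω _ => ?_
    split_ifs <;> simp
  · intro ω _
    split_ifs
    · exact P.apply_ne_top ω
    · simp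

theorem pr_nonneg {Ω α : Type} (P : PMF Ω) (X : Ω → α) (x : α) : 0 ≤ pr P X x :=
  ENNReal.toReal_nonneg

theorem sum_pr_mul (X : Ω → α) (g : α → ℝ) :
    ∑ x, pr P X x * g x = ∑ ω, (P ω).toReal * g (X ω) := by
  classical
  simp_rw [pr_eq_sum, Finset.sum_mul, ite_mul, zero_mul]
  rw [Finset.sum_comm]
  refine Finset.sum_congr rfl fun ω _ => ?_
  simp

theorem sum_pr (X : Ω → α) : ∑ x, pr P X x = 1 := by
  simpa [pmf_sum_toReal] using sum_pr_mul P X (fun _ => 1)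

theorem sum_mul_congr_of_map_eq {X Y : Ω → α} (h : P.map X = P.map Y) (g : α → ℝ) :
    ∑ ω, (P ω).toReal * g (X ω) = ∑ ω, (P ω).toReal * g (Y ω) := by
  rw [← sum_pr_mul, ← sum_pr_mul]
  simp only [pr, h]

theorem pr_mono {α β : Type} {X : Ω → α} {Y : Ω → β} {x : α} {y : β}
    (h : ∀ ω, X ω = x → Y ω = y) : pr P X x ≤ pr P Y y := by
  classical
  rw [pr_eq_sum, pr_eq_sum]
  refine Finset.sum_le_sum fun ω _ => ?_
  by_cases hx : x = X ω
  · rw [if_pos hx, if_pos (h ω hx.symm).symm]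
  · rw [if_neg hx]
    split_ifs <;> simp

theorem le_pr_self {α : Type} (X : Ω → α) (ω : Ω) : (P ω).toReal ≤ pr P X (X ω) := by
  classical
  rw [pr_eq_sum]
  refine le_trans (by simp) (Finset.single_le_sum (f := fun ω' =>
    if X ω = X ω' then (P ω').toReal else 0) (fun ω' _ => ?_) (Finset.mem_univ ω))
  split_ifs <;> simp

theorem sum_pr_pair_right {α : Type} (X : Ω → α) (Y : Ω → β) (x : α) :
    ∑ y, pr P (fun ω => (X ω, Y ω)) (x, y) = pr P X x := by
  classical
  simp_rw [pr_eq_sum, Prod.mk.injEq, ite_and]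
  rw [Finset.sum_comm]
  refine Finset.sum_congr rfl fun ω _ => ?_
  split_ifs with h <;> simp

theorem sum_pr_pair_left {β : Type} (X : Ω → α) (Y : Ω → β) (y : β) :
    ∑ x, pr P (fun ω => (X ω, Y ω)) (x, y) = pr P Y y := by
  classical
  simp_rw [pr_eq_sum, Prod.mk.injEq, and_comm (b := y = _), ite_and]
  rw [Finset.sum_comm]
  refine Finset.sum_congr rfl fun ω _ => ?_
  split_ifs with h <;> simp

theorem entropy_mul_log (X : Ω → α) :
    entropy P X * Real.log 2 = -∑ ω, (P ω).toReal * Real.log (pr P X (X ω)) := by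
  have h2 : Real.log 2 ≠ 0 := (Real.log_pos one_lt_two).ne'
  rw [entropy, div_mul_cancel₀ _ h2, ← sum_pr_mul P X (fun x => Real.log (pr P X x)),
    ← Finset.sum_neg_distrib]
  refine Finset.sum_congr rfl fun x _ => ?_
  rw [Real.negMulLog, pr]
  ring

/-- A function of a random variable has no more entropy than this random variable. -/
theorem entropy_le_of_determined {X : Ω → α} {Y : Ω → β}
    (h : ∀ ω ω', Y ω = Y ω' → X ω = X ω') : entropy P X ≤ entropy P Y := by
  have h2 : 0 < Real.log 2 := Real.log_pos one_lt_two
  rw [← mul_le_mul_iff_left₀ h2, entropy_mul_log, entropy_mul_log, neg_le_neg_iff]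
  refine Finset.sum_le_sum fun ω _ => ?_
  rcases (ENNReal.toReal_nonneg (a := P ω)).eq_or_lt with h0 | h0
  · simp [← h0]
  · refine mul_le_mul_of_nonneg_left (Real.log_le_log (h0.trans_le (le_pr_self P Y ω)) ?_) h0.le
    exact pr_mono P fun ω' h' => h ω' ω h'

theorem entropy_congr {X : Ω → α} {Y : Ω → β} (h : ∀ ω ω', Y ω = Y ω' ↔ X ω = X ω') :
    entropy P X = entropy P Y :=
  le_antisymm (entropy_le_of_determined P fun ω ω' => (h ω ω').1)
    (entropy_le_of_determined P fun ω ω' => (h ω ω').2)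

theorem condEntropy_congr {α' β' : Type} [Fintype α'] [Fintype β'] {X : Ω → α} {X' : Ω → α'}
    {Y : Ω → β} {Y' : Ω → β'} (hX : ∀ ω ω', Y ω = Y ω' → (X ω = X ω' ↔ X' ω = X' ω'))
    (hY : ∀ ω ω', Y ω = Y ω' ↔ Y' ω = Y' ω') : condEntropy P X Y = condEntropy P X' Y' := by
  rw [condEntropy, condEntropy, entropy_congr P (X := Y) (Y := Y') fun ω ω' => (hY ω ω').symm]
  congr 1
  refine entropy_congr P fun ω ω' => ?_
  rw [Prod.mk.injEq, Prod.mk.injEq, ← hY]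
  constructor
  · rintro ⟨h1, h2⟩
    exact ⟨(hX ω ω' h2).2 h1, h2⟩
  · rintro ⟨h1, h2⟩
    exact ⟨(hX ω ω' h2).1 h1, h2⟩

theorem condEntropy_eq_zero_of_determined {X : Ω → α} {Y : Ω → β}
    (h : ∀ ω ω', Y ω = Y ω' → X ω = X ω') : condEntropy P X Y = 0 := by
  rw [condEntropy, sub_eq_zero]
  refine entropy_congr P fun ω ω' => ?_
  rw [Prod.mk.injEq]
  exact ⟨fun h' => ⟨h _ _ h', h'⟩, fun h' => h'.2⟩

theorem condEntropy_nonneg (X : Ω → α) (Y : Ω → β) : 0 ≤ condEntropy P X Y :=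
  sub_nonneg.2 <| entropy_le_of_determined P fun _ _ h => (Prod.mk.inj h).2

theorem entropy_const (c : α) : entropy P (fun _ => c) = 0 := by
  have h' := entropy_mul_log P (fun _ : Ω => c)
  have h1 : pr P (fun _ : Ω => c) c = 1 := by
    rw [pr_eq_sum]
    simp [pmf_sum_toReal]
  simpa [h1, (Real.log_pos one_lt_two).ne'] using h'

/-- Gibbs' inequality, with its equality case. -/
theorem gibbs {f g : α → ℝ} (hf : ∀ x, 0 ≤ f x) (hg : ∀ x, 0 ≤ g x)
    (hfg : ∀ x, g x = 0 → f x = 0) (hsum : ∑ x, f x = ∑ x, g x) :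
    0 ≤ ∑ x, f x * Real.log (f x / g x) ∧
      (∑ x, f x * Real.log (f x / g x) = 0 → ∀ x, f x = g x) := by
  have key : ∑ x, f x * Real.log (f x / g x) =
      ∑ x, g x * InformationTheory.klFun (f x / g x) := by
    -- The totals agree, so `∑ g - ∑ f = 0` may be added. Termwise this turns `f log (f / g)` into
    -- the nonnegative `g * klFun (f / g)`.
    rw [← add_zero (∑ x, f x * Real.log (f x / g x)), ← sub_self (∑ x, g x)]
    nth_rw 2 [← hsum]
    rw [← Finset.sum_sub_distrib, ← Finset.sum_add_distrib]
    refine Finset.sum_congr rfl fun x _ => ?_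
    rw [InformationTheory.klFun]
    rcases eq_or_ne (g x) 0 with h | h
    · simp [h, hfg x h]
    · field_simp
      ring
  have hnn : ∀ x, 0 ≤ g x * InformationTheory.klFun (f x / g x) := fun x =>
    mul_nonneg (hg x) (InformationTheory.klFun_nonneg (div_nonneg (hf x) (hg x)))
  refine ⟨key ▸ Finset.sum_nonneg fun x _ => hnn x, fun h x => ?_⟩
  rw [key, Finset.sum_eq_zero_iff_of_nonneg fun x _ => hnn x] at h
  rcases mul_eq_zero.1 (h x (Finset.mem_univ x)) with h0 | h0
  · rw [h0, hfg x h0]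
  · rw [InformationTheory.klFun_eq_zero_iff (div_nonneg (hf x) (hg x))] at h0
    refine eq_of_div_eq_one h0

theorem entropy_le_logb_card [Nonempty α] (X : Ω → α) :
    entropy P X ≤ Real.logb 2 (Fintype.card α) := by
  have h2 : 0 < Real.log 2 := Real.log_pos one_lt_two
  have hc : (0 : ℝ) < Fintype.card α := by exact_mod_cast Fintype.card_pos
  rw [entropy, Real.logb, div_le_div_iff_of_pos_right h2]
  have h := (gibbs (f := pr P X) (g := fun _ => (Fintype.card α : ℝ)⁻¹) (pr_nonneg P X)
    (fun _ => by positivity) (fun x h => absurd h (by positivity)) (by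
      rw [sum_pr]
      simp [hc.ne'])).1
  have : ∑ x, pr P X x * Real.log (pr P X x / (Fintype.card α : ℝ)⁻¹) =
      Real.log (Fintype.card α) - ∑ x, Real.negMulLog (pr P X x) := by
    rw [← one_mul (Real.log (Fintype.card α : ℝ)), ← sum_pr P X, Finset.sum_mul,
      ← Finset.sum_sub_distrib]
    refine Finset.sum_congr rfl fun x _ => ?_
    rcases eq_or_ne (pr P X x) 0 with h | h
    · simp [h]
    · rw [div_inv_eq_mul, Real.log_mul h hc.ne', Real.negMulLog]
      ring
  rw [this] at h
  exact sub_nonneg.1 h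

/-- The conditional mutual information is nonnegative, and vanishes exactly in the case of
conditional independence. -/
theorem condMutualInfo_nonneg_and_eq_zero_iff (X : Ω → α) (Y : Ω → β) (Z : Ω → γ) :
    0 ≤ condMutualInfo P X Y Z ∧ (condMutualInfo P X Y Z = 0 ↔
      ∀ x y z, pr P (fun ω => (X ω, Y ω, Z ω)) (x, y, z) * pr P Z z =
        pr P (fun ω => (X ω, Z ω)) (x, z) * pr P (fun ω => (Y ω, Z ω)) (y, z)) := by
  have h2 : 0 < Real.log 2 := Real.log_pos one_lt_two
  set f : α × β × γ → ℝ := pr P (fun ω => (X ω, Y ω, Z ω)) with hf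
  -- `g` is the joint law with the same pair marginals that makes `X` and `Y` conditionally
  -- independent given `Z`. The mutual information is the divergence of `f` from `g`, so Gibbs'
  -- inequality applies.
  set g : α × β × γ → ℝ := fun t => pr P (fun ω => (X ω, Z ω)) (t.1, t.2.2) *
    pr P (fun ω => (Y ω, Z ω)) (t.2.1, t.2.2) / pr P Z t.2.2 with hg
  have hf0 : ∀ t, 0 ≤ f t := pr_nonneg P _
  have hg0 : ∀ t, 0 ≤ g t := fun t =>
    div_nonneg (mul_nonneg (pr_nonneg P _ _) (pr_nonneg P _ _)) (pr_nonneg P _ _)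
  have hXZ : ∀ t, f t ≤ pr P (fun ω => (X ω, Z ω)) (t.1, t.2.2) := fun t =>
    pr_mono P fun ω h => by rw [← h]
  have hYZ : ∀ t, f t ≤ pr P (fun ω => (Y ω, Z ω)) (t.2.1, t.2.2) := fun t =>
    pr_mono P fun ω h => by rw [← h]
  have hZ : ∀ t, f t ≤ pr P Z t.2.2 := fun t => pr_mono P fun ω h => by rw [← h]
  have hfg : ∀ t, g t = 0 → f t = 0 := by
    intro t ht
    refine le_antisymm ?_ (hf0 t)
    rcases div_eq_zero_iff.1 ht with h | h
    · rcases mul_eq_zero.1 h with h | h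
      · exact h ▸ hXZ t
      · exact h ▸ hYZ t
    · exact h ▸ hZ t
  have hsum : ∑ t, f t = ∑ t, g t := by
    rw [hf, sum_pr, hg, Fintype.sum_prod_type]
    simp_rw [Fintype.sum_prod_type]
    rw [Finset.sum_comm]
    have : ∀ y : β, ∑ x, ∑ z, pr P (fun ω => (X ω, Z ω)) (x, z) *
        pr P (fun ω => (Y ω, Z ω)) (y, z) / pr P Z z =
        ∑ z, pr P (fun ω => (Y ω, Z ω)) (y, z) := by
      intro y
      rw [Finset.sum_comm]
      refine Finset.sum_congr rfl fun z _ => ?_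
      rw [← Finset.sum_div, ← Finset.sum_mul, sum_pr_pair_left]
      rcases eq_or_ne (pr P Z z) 0 with h | h
      · have : pr P (fun ω => (Y ω, Z ω)) (y, z) = 0 :=
          le_antisymm (h ▸ pr_mono P fun ω h => (Prod.mk.inj h).2) (pr_nonneg P _ _)
        simp [this]
      · field_simp
    simp_rw [this, sum_pr_pair_right, sum_pr]
  obtain ⟨h1, h3⟩ := gibbs hf0 hg0 hfg hsum
  have key : condMutualInfo P X Y Z * Real.log 2 = ∑ t, f t * Real.log (f t / g t) := by
    rw [hf, sum_pr_mul P _ (fun t => Real.log (f t / g t)), condMutualInfo, condEntropy,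
      condEntropy]
    simp only [sub_mul, entropy_mul_log, ← Finset.sum_neg_distrib, ← Finset.sum_sub_distrib]
    refine Finset.sum_congr rfl fun ω _ => ?_
    rcases (ENNReal.toReal_nonneg (a := P ω)).eq_or_lt with h0 | h0
    · simp [← h0]
    · have e1 : 0 < f (X ω, Y ω, Z ω) := h0.trans_le (le_pr_self P _ ω)
      have e2 := e1.trans_le (hXZ _)
      have e3 := e1.trans_le (hYZ _)
      have e4 := e1.trans_le (hZ _)
      rw [hg, Real.log_div e1.ne' (by positivity)]
      simp only at e2 e3 e4 ⊢
      rw [Real.log_div (by positivity) e4.ne', Real.log_mul e2.ne' e3.ne']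
      ring
  refine ⟨nonneg_of_mul_nonneg_left (key ▸ h1) h2, fun h x y z => ?_, fun h => ?_⟩
  · have hz := h3 (by rw [← key, h, zero_mul]) (x, y, z)
    rw [hz]
    simp only [hg]
    rcases eq_or_ne (pr P Z z) 0 with h | h
    · have : pr P (fun ω => (Y ω, Z ω)) (y, z) = 0 :=
        le_antisymm (h ▸ pr_mono P fun ω h => (Prod.mk.inj h).2) (pr_nonneg P _ _)
      simp [this]
    · field_simp
  · refine (mul_eq_zero.1 (key.trans ?_)).resolve_right h2.ne'
    refine Finset.sum_eq_zero fun t _ => ?_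
    rcases eq_or_ne (f t) 0 with h0 | h0
    · simp [h0]
    · have hp : 0 < f t := lt_of_le_of_ne (hf0 t) h0.symm
      have : f t = g t := by
        simp only [hg]
        rw [eq_div_iff (hp.trans_le (hZ t)).ne']
        exact h t.1 t.2.1 t.2.2
      rw [← this, div_self h0, Real.log_one, mul_zero]

theorem condEntropy_pair_le (X : Ω → α) (Y : Ω → β) (Z : Ω → γ) :
    condEntropy P X (fun ω => (Y ω, Z ω)) ≤ condEntropy P X Z :=
  sub_nonneg.1 (condMutualInfo_nonneg_and_eq_zero_iff P X Y Z).1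

/-- Conditioning on more reduces entropy. -/
theorem condEntropy_le_of_determined (X : Ω → α) {Y : Ω → β} {Z : Ω → γ}
    (h : ∀ ω ω', Y ω = Y ω' → Z ω = Z ω') : condEntropy P X Y ≤ condEntropy P X Z := by
  refine le_trans (le_of_eq ?_) (condEntropy_pair_le P X Y Z)
  refine condEntropy_congr P (fun _ _ _ => Iff.rfl) fun ω ω' => ?_
  rw [Prod.mk.injEq]
  exact ⟨fun h' => ⟨h', h _ _ h'⟩, fun h' => h'.1⟩

theorem condEntropy_le_entropy (X : Ω → α) (Y : Ω → β) : condEntropy P X Y ≤ entropy P X := by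
  refine (condEntropy_le_of_determined P X (Z := fun _ => ()) fun _ _ _ => rfl).trans ?_
  rw [condEntropy, entropy_const, sub_zero]
  exact entropy_le_of_determined P fun _ _ h => by rw [h]

theorem entropy_pair_le (X : Ω → α) (Y : Ω → β) :
    entropy P (fun ω => (X ω, Y ω)) ≤ entropy P X + entropy P Y := by
  have := condEntropy_le_entropy P X Y
  rw [condEntropy] at this
  linarith

end Shannon

/-! ### Samples with two independent components -/

section Product

variable {Ω Θ α β : Type} [Fintype Ω] [Fintype Θ] [Fintype α] [Fintype β]
  {P : PMF (Ω × Θ)} {u : PMF Ω} {v : PMF Θ}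

/-- Chain rule: independence leaves the first component with law `u` under every value of the
second. It serves to freeze the demands and the seed, so that only the library stays random. -/
theorem entropy_pair_snd (hP : ∀ a b, (P (a, b)).toReal = (u a).toReal * (v b).toReal)
    (Y : Ω × Θ → α) : entropy P (fun ω => (Y ω, ω.2)) =
      entropy v id + ∑ b, (v b).toReal * entropy u (fun a => Y (a, b)) := by
  classical
  have h2 : Real.log 2 ≠ 0 := (Real.log_pos one_lt_two).ne'
  apply mul_right_cancel₀ h2
  have hpr : ∀ a b, pr P (fun ω => (Y ω, ω.2)) (Y (a, b), b) =
      (v b).toReal * pr u (fun a => Y (a, b)) (Y (a, b)) := by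
    intro a b
    rw [pr_eq_sum, pr_eq_sum, Fintype.sum_prod_type, Finset.mul_sum]
    refine Finset.sum_congr rfl fun a' _ => ?_
    rw [Finset.sum_eq_single b]
    · simp only [hP, Prod.mk.injEq, and_true, ite_mul, zero_mul, mul_comm (v b).toReal]
    · intro b' _ hb
      simp [hb.symm]
    · simp
  have hv : ∀ b, pr v id b = (v b).toReal := by
    intro b
    rw [pr, PMF.map_id]
  rw [add_mul, entropy_mul_log, entropy_mul_log, Finset.sum_mul]
  simp_rw [mul_assoc, entropy_mul_log, mul_neg, Finset.sum_neg_distrib, Finset.mul_sum]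
  rw [Fintype.sum_prod_type, Finset.sum_comm, ← neg_add, ← Finset.sum_add_distrib]
  congr 1
  refine Finset.sum_congr rfl fun b _ => ?_
  have : (v b).toReal * Real.log (pr v id (id b)) =
      ∑ a, (u a).toReal * ((v b).toReal * Real.log (pr v id (id b))) := by
    rw [← Finset.sum_mul, pmf_sum_toReal, one_mul]
  rw [this, ← Finset.sum_add_distrib]
  refine Finset.sum_congr rfl fun a _ => ?_
  rw [hP, hpr, id, hv]
  rcases (ENNReal.toReal_nonneg (a := u a)).eq_or_lt with h0 | h0
  · simp [← h0]
  rcases (ENNReal.toReal_nonneg (a := v b)).eq_or_lt with h1 | h1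
  · simp [← h1]
  rw [Real.log_mul h1.ne' (h0.trans_le (le_pr_self u (fun a => Y (a, b)) a)).ne']
  ring

/-- The entropy of `Y` is at least its average given the second component of the sample. -/
theorem sum_entropy_le (hP : ∀ a b, (P (a, b)).toReal = (u a).toReal * (v b).toReal)
    (Y : Ω × Θ → α) : ∑ b, (v b).toReal * entropy u (fun a => Y (a, b)) ≤ entropy P Y := by
  have h := condEntropy_le_entropy P Y Prod.snd
  rw [condEntropy, entropy_pair_snd hP] at h
  have h' := entropy_pair_snd hP (fun _ => ())
  simp only [entropy_const, mul_zero, Finset.sum_const_zero, add_zero] at h'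
  have h'' : entropy P (fun ω => ((), ω.2)) = entropy P Prod.snd :=
    entropy_congr P fun _ _ => by simp
  linarith

/-- The conditional entropy is at least its average given the second component of the sample. -/
theorem sum_condEntropy_le (hP : ∀ a b, (P (a, b)).toReal = (u a).toReal * (v b).toReal)
    (X : Ω × Θ → α) (Y : Ω × Θ → β) :
    ∑ b, (v b).toReal * condEntropy u (fun a => X (a, b)) (fun a => Y (a, b)) ≤
      condEntropy P X Y := by
  refine le_trans (le_of_eq ?_) (condEntropy_le_of_determined P X (Y := fun ω => (Y ω, ω.2))
    fun ω ω' h => (Prod.mk.inj h).1)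
  have h1 : entropy P (fun ω => (X ω, Y ω, ω.2)) = entropy P (fun ω => ((X ω, Y ω), ω.2)) :=
    entropy_congr P fun _ _ => by simp [and_assoc]
  rw [condEntropy, h1, entropy_pair_snd hP, entropy_pair_snd hP]
  simp_rw [condEntropy, mul_sub, Finset.sum_sub_distrib]
  ring

end Product

/-! ## Bits of a uniform library -/

section Bits

variable {N B : ℕ}

/-- The bits of the library at the positions in `T`. -/
def bits (T : Finset (Fin N × Fin B)) (F : Library N B) : Fin N × Fin B → ZMod 2 :=
  fun x => if x ∈ T then F x.1 x.2 else 0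

theorem bits_eq_iff {T : Finset (Fin N × Fin B)} {F F' : Library N B} :
    bits T F = bits T F' ↔ ∀ x ∈ T, F x.1 x.2 = F' x.1 x.2 := by
  rw [funext_iff]
  refine forall_congr' fun x => ?_
  by_cases h : x ∈ T <;> simp [bits, h]

/-- The positions of the bits of file `j`. -/
def row (j : Fin N) : Finset (Fin N × Fin B) := Finset.univ.filter fun x => x.1 = j

theorem mem_row {j : Fin N} {x : Fin N × Fin B} : x ∈ row j ↔ x.1 = j := by simp [row]

theorem card_row (j : Fin N) : (row j : Finset (Fin N × Fin B)).card = B := by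
  have : (row j : Finset (Fin N × Fin B)) = {j} ×ˢ Finset.univ := by
    ext x
    rw [mem_row, Finset.mem_product]
    simp
  rw [this, Finset.card_product]
  simp

variable (N B) in
/-- The law of the library. -/
abbrev uniformLibrary : PMF (Library N B) := PMF.uniformOfFintype (Library N B)

theorem entropy_bits_le (T : Finset (Fin N × Fin B)) :
    entropy (uniformLibrary N B) (bits T) ≤ T.card := by
  have h : entropy (uniformLibrary N B) (bits T) =
      entropy (uniformLibrary N B) (fun F (x : T) => F x.1.1 x.1.2) := by
    refine entropy_congr _ fun F F' => ?_
    rw [bits_eq_iff, funext_iff]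
    simp
  rw [h]
  refine (entropy_le_logb_card _ _).trans (le_of_eq ?_)
  rw [Fintype.card_fun, ZMod.card, Fintype.card_coe]
  push_cast
  rw [Real.logb_pow, Real.logb_self_eq_one one_lt_two, mul_one]

theorem entropy_bits_univ :
    entropy (uniformLibrary N B) (bits Finset.univ) = (N * B : ℕ) := by
  have h2 : Real.log 2 ≠ 0 := (Real.log_pos one_lt_two).ne'
  have h : entropy (uniformLibrary N B) (bits Finset.univ) =
      entropy (uniformLibrary N B) id := by
    refine entropy_congr _ fun F F' => ?_
    rw [bits_eq_iff]
    constructor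
    · rintro rfl
      simp
    · intro h
      ext i b
      exact h (i, b) (Finset.mem_univ _)
  apply mul_right_cancel₀ h2
  rw [h, entropy_mul_log]
  have : ∀ F : Library N B, pr (uniformLibrary N B) id (id F) = ((2 : ℝ) ^ (N * B))⁻¹ := by
    intro F
    rw [pr, PMF.map_id, PMF.uniformOfFintype_apply, Fintype.card_fun, Fintype.card_fun, ZMod.card]
    simp [← pow_mul, mul_comm]
  simp_rw [this, ← Finset.sum_mul, pmf_sum_toReal, one_mul, Real.log_inv, neg_neg, Real.log_pow]

/-- The cardinality bound holds for `T` and for its complement, and by subadditivity the two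
entropies add up to at least the `N * B` bits of the whole library, so both bounds are tight. -/
theorem entropy_bits (T : Finset (Fin N × Fin B)) :
    entropy (uniformLibrary N B) (bits T) = T.card := by
  refine le_antisymm (entropy_bits_le T) ?_
  have h : entropy (uniformLibrary N B) (bits Finset.univ) ≤
      entropy (uniformLibrary N B) (fun F => (bits T F, bits Tᶜ F)) := by
    refine entropy_le_of_determined _ fun F F' h => ?_
    rw [Prod.mk.injEq, bits_eq_iff, bits_eq_iff] at h
    rw [bits_eq_iff]
    intro x _
    by_cases hx : x ∈ T
    · exact h.1 x hx
    · exact h.2 x (Finset.mem_compl.2 hx)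
  have h1 := entropy_pair_le (uniformLibrary N B) (bits T) (bits Tᶜ)
  have h2 := entropy_bits_le Tᶜ
  rw [entropy_bits_univ] at h
  have h3 : T.card + Tᶜ.card = N * B := by
    rw [Finset.card_add_card_compl]
    simp
  have h4 : (T.card : ℝ) + Tᶜ.card = (N * B : ℕ) := by exact_mod_cast h3
  linarith

variable {α β : Type} [Fintype α] [Fintype β] {p : Library N B → α} {p' : Library N B → β}

/-- The remaining uncertainty on file `j`, given two signals and the bits at the positions `C`. -/
def fileResidual (p : Library N B → α) (p' : Library N B → β) (j : Fin N)
    (C : Finset (Fin N × Fin B)) : ℝ :=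
  condEntropy (uniformLibrary N B) (bits (row j)) (fun F => ((p F, p' F), bits C F))

theorem fileResidual_comm (j : Fin N) (C : Finset (Fin N × Fin B)) :
    fileResidual p p' j C = fileResidual p' p j C :=
  condEntropy_congr _ (fun _ _ _ => Iff.rfl) fun F F' => by
    simp only [Prod.mk.injEq, and_comm (a := p F = _)]

theorem fileResidual_nonneg (j : Fin N) (C : Finset (Fin N × Fin B)) : 0 ≤ fileResidual p p' j C :=
  condEntropy_nonneg _ _ _

theorem bits_eq_of_subset {T U : Finset (Fin N × Fin B)} (h : T ⊆ U) {F F' : Library N B}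
    (hF : bits U F = bits U F') : bits T F = bits T F' :=
  bits_eq_iff.2 fun x hx => bits_eq_iff.1 hF x (h hx)

theorem bits_union_eq_iff {T U : Finset (Fin N × Fin B)} {F F' : Library N B} :
    bits (T ∪ U) F = bits (T ∪ U) F' ↔ bits T F = bits T F' ∧ bits U F = bits U F' := by
  simp only [bits_eq_iff, Finset.mem_union, or_imp, forall_and]

/-- Given the bits at `V = U ∪ C`, the signal `p'` is known, so `p` reveals file `j` up to the
residual. Hence `p` must carry the bits of the file outside `V`, besides whatever uncertainty it
keeps once the file is known as well. Iteration adds one file at a time to the conditioning. -/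
theorem condEntropy_step (j : Fin N) (U C : Finset (Fin N × Fin B))
    (hp' : condEntropy (uniformLibrary N B) p' (bits C) = 0) :
    ((row j \ (U ∪ C)).card : ℝ) +
      condEntropy (uniformLibrary N B) p (bits (U ∪ C ∪ row j)) ≤
      condEntropy (uniformLibrary N B) p (bits U) + fileResidual p p' j C := by
  set V := U ∪ C with hV
  have h1 : condEntropy (uniformLibrary N B) p (bits V) ≤ condEntropy (uniformLibrary N B) p (bits U) :=
    condEntropy_le_of_determined (uniformLibrary N B) p fun F F' => bits_eq_of_subset Finset.subset_union_left
  have h2 : condEntropy (uniformLibrary N B) (bits (row j)) (fun F => (p F, bits V F)) ≤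
      condEntropy (uniformLibrary N B) (bits (row j)) (fun F => (p F, bits C F)) := by
    refine condEntropy_le_of_determined (uniformLibrary N B) _ fun F F' h => ?_
    rw [Prod.mk.injEq] at h ⊢
    exact ⟨h.1, bits_eq_of_subset Finset.subset_union_right h.2⟩
  have h3 : entropy (uniformLibrary N B) (fun F => ((p F, p' F), bits C F)) ≤ entropy (uniformLibrary N B) (fun F => (p F, bits C F)) := by
    have h := condEntropy_le_of_determined (uniformLibrary N B) p' (Y := fun F => (p F, bits C F)) (Z := bits C)
      fun F F' h => (Prod.mk.inj h).2
    rw [hp', condEntropy] at h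
    have h' : entropy (uniformLibrary N B) (fun F => ((p F, p' F), bits C F)) =
        entropy (uniformLibrary N B) (fun F => (p' F, p F, bits C F)) :=
      entropy_congr (uniformLibrary N B) fun F F' => by
        simp only [Prod.mk.injEq]
        tauto
    linarith
  have h4 : entropy (uniformLibrary N B) (fun F => (bits (row j) F, p F, bits C F)) ≤
      entropy (uniformLibrary N B) (fun F => (bits (row j) F, (p F, p' F), bits C F)) :=
    entropy_le_of_determined (uniformLibrary N B) fun F F' h => by
      simp only [Prod.mk.injEq] at h ⊢
      tauto
  have h5 : entropy (uniformLibrary N B) (fun F => (bits (row j) F, p F, bits V F)) =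
      entropy (uniformLibrary N B) (fun F => (p F, bits (V ∪ row j) F)) :=
    entropy_congr (uniformLibrary N B) fun F F' => by
      simp only [Prod.mk.injEq, bits_union_eq_iff]
      tauto
  have h6 : ((V ∪ row j).card : ℝ) = V.card + (row j \ V).card := by
    rw [Finset.union_comm, ← Finset.card_sdiff_add_card]
    push_cast
    ring
  simp only [fileResidual, condEntropy, entropy_bits] at *
  linarith

/-- A bit that neither user caches cannot be recovered from the signals. -/
theorem card_row_sdiff_le (j : Fin N) (A C : Finset (Fin N × Fin B))
    (hp : condEntropy (uniformLibrary N B) p (bits A) = 0)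
    (hp' : condEntropy (uniformLibrary N B) p' (bits C) = 0) :
    ((row j \ (A ∪ C)).card : ℝ) ≤ fileResidual p p' j C := by
  have h := condEntropy_step (p := p) j A C hp'
  have := condEntropy_nonneg (uniformLibrary N B) p (bits (A ∪ C ∪ row j))
  linarith

theorem card_row_sdiff_le' (j : Fin N) (A C : Finset (Fin N × Fin B))
    (hp : condEntropy (uniformLibrary N B) p (bits A) = 0)
    (hp' : condEntropy (uniformLibrary N B) p' (bits C) = 0) :
    ((row j \ (A ∪ C)).card : ℝ) ≤ fileResidual p p' j A := by
  rw [Finset.union_comm, fileResidual_comm]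
  exact card_row_sdiff_le j C A hp' hp

theorem entropy_ge_of_one {f : Fin N} {C : Finset (Fin N × Fin B)}
    (hC : condEntropy (uniformLibrary N B) p' (bits C) = 0) :
    ((row f \ C).card : ℝ) + condEntropy (uniformLibrary N B) p (bits (C ∪ row f)) ≤
      entropy (uniformLibrary N B) p + fileResidual p p' f C := by
  have h := condEntropy_step (p := p) f ∅ C hC
  rw [Finset.empty_union] at h
  have := condEntropy_le_entropy (uniformLibrary N B) p (bits ∅)
  linarith

theorem row_sdiff_union {f g : Fin N} (h : f ≠ g) (U : Finset (Fin N × Fin B)) :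
    (row f \ (U ∪ row g) : Finset (Fin N × Fin B)) = row f \ U := by
  ext x
  simp only [Finset.mem_sdiff, Finset.mem_union, mem_row]
  constructor
  · tauto
  · rintro ⟨rfl, h'⟩
    tauto

/-- The second step conditions on file `f₁` too, which uncovers no bit of `f₂`. The remaining
conditional entropy of `p` is kept on the left as the start of a third step. -/
theorem entropy_ge_of_two {f₁ f₂ : Fin N} (h : f₂ ≠ f₁) {C₁ C₂ : Finset (Fin N × Fin B)}
    (h₁ : condEntropy (uniformLibrary N B) p' (bits C₁) = 0)
    (h₂ : condEntropy (uniformLibrary N B) p' (bits C₂) = 0) :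
    ((row f₁ \ C₁).card : ℝ) + (row f₂ \ (C₁ ∪ C₂)).card +
      condEntropy (uniformLibrary N B) p (bits (C₁ ∪ row f₁ ∪ C₂ ∪ row f₂)) ≤
      entropy (uniformLibrary N B) p + fileResidual p p' f₁ C₁ + fileResidual p p' f₂ C₂ := by
  have h3 := entropy_ge_of_one (p := p) (f := f₁) h₁
  have h4 := condEntropy_step (p := p) f₂ (C₁ ∪ row f₁) C₂ h₂
  rw [Finset.union_right_comm, row_sdiff_union h, Finset.union_right_comm C₁ C₂] at h4
  linarith

theorem entropy_ge_of_three {f₁ f₂ f₃ : Fin N} (h₂₁ : f₂ ≠ f₁) (h₃₁ : f₃ ≠ f₁) (h₃₂ : f₃ ≠ f₂)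
    {C₁ C₂ C₃ : Finset (Fin N × Fin B)}
    (h₁ : condEntropy (uniformLibrary N B) p' (bits C₁) = 0)
    (h₂ : condEntropy (uniformLibrary N B) p' (bits C₂) = 0)
    (h₃ : condEntropy (uniformLibrary N B) p' (bits C₃) = 0) :
    ((row f₁ \ C₁).card : ℝ) + (row f₂ \ (C₁ ∪ C₂)).card + (row f₃ \ (C₁ ∪ C₂ ∪ C₃)).card ≤
      entropy (uniformLibrary N B) p + fileResidual p p' f₁ C₁ + fileResidual p p' f₂ C₂ +
        fileResidual p p' f₃ C₃ := by
  have h4 := entropy_ge_of_two (p := p) h₂₁ h₁ h₂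
  have h5 := condEntropy_step (p := p) f₃ (C₁ ∪ row f₁ ∪ C₂ ∪ row f₂) C₃ h₃
  have h6 : (row f₃ \ (C₁ ∪ row f₁ ∪ C₂ ∪ row f₂ ∪ C₃) : Finset (Fin N × Fin B)) =
      row f₃ \ (C₁ ∪ C₂ ∪ C₃) := by
    rw [Finset.union_right_comm, row_sdiff_union h₃₂, Finset.union_assoc,
      Finset.union_right_comm, row_sdiff_union h₃₁, Finset.union_assoc C₁]
  rw [h6] at h5
  have := condEntropy_nonneg (uniformLibrary N B) p
    (bits (C₁ ∪ row f₁ ∪ C₂ ∪ row f₂ ∪ C₃ ∪ row f₃))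
  linarith

end Bits

/-! ### Counting the bits that caches miss -/

section Counting

variable {ι : Type} [DecidableEq ι] (R A₁ A₂ A₃ C₁ C₂ C₃ : Finset ι)

theorem card_sdiff_eq_sum (R A : Finset ι) : (R \ A).card = ∑ x ∈ R, if x ∈ A then 0 else 1 := by
  rw [Finset.sdiff_eq_filter, Finset.card_filter]
  refine Finset.sum_congr rfl fun x _ => ?_
  split_ifs <;> simp_all

/-- A bit covered by every pair `Aᵢ ∪ Cⱼ` and missing from some `Aᵢ` lies in all the `Cⱼ`. It then
counts at most twice on the left, the second time only if both `Aᵢ` miss it. The last bracket pays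
for the bits that some pair leaves uncovered. -/
theorem card_sdiff_two_le :
    (R \ A₁).card + (R \ A₂).card + (R \ C₁).card + (R \ C₂).card ≤
      R.card + (R \ (A₁ ∪ A₂)).card + (R \ (C₁ ∪ C₂)).card +
        ((R \ (A₁ ∪ C₁)).card + (R \ (A₁ ∪ C₂)).card + (R \ (A₂ ∪ C₁)).card +
          (R \ (A₂ ∪ C₂)).card) := by
  simp only [card_sdiff_eq_sum, Finset.card_eq_sum_ones R, ← Finset.sum_add_distrib,
    Finset.mem_union]
  refine Finset.sum_le_sum fun x _ => ?_
  by_cases x ∈ A₁ <;> by_cases x ∈ A₂ <;> by_cases x ∈ C₁ <;> by_cases x ∈ C₂ <;> simp [*]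

/-- The same count with three caches on each side. The pair `A₂ ∪ C₂` can be left out: a bit missing
from just these two counts twice, which `2 * R.card` absorbs. This matters, because `A₂` and `C₂`
come from different demand vectors and neither decodes the third file. -/
theorem card_sdiff_three_le :
    (R \ A₁).card + (R \ A₂).card + (R \ A₃).card + (R \ C₁).card + (R \ C₂).card +
        (R \ C₃).card ≤
      2 * R.card + (R \ (A₁ ∪ A₂ ∪ A₃)).card + (R \ (C₁ ∪ C₂ ∪ C₃)).card +
        ((R \ (A₁ ∪ C₁)).card + (R \ (A₁ ∪ C₂)).card + (R \ (A₂ ∪ C₁)).card +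
          (R \ (A₁ ∪ C₃)).card + (R \ (A₂ ∪ C₃)).card + (R \ (A₃ ∪ C₃)).card +
          (R \ (A₃ ∪ C₁)).card + (R \ (A₃ ∪ C₂)).card) := by
  simp only [card_sdiff_eq_sum, Finset.card_eq_sum_ones R, ← Finset.sum_add_distrib,
    Finset.mem_union, Finset.mul_sum]
  refine Finset.sum_le_sum fun x _ => ?_
  by_cases x ∈ A₁ <;> by_cases x ∈ A₂ <;> by_cases x ∈ A₃ <;> by_cases x ∈ C₁ <;>
    by_cases x ∈ C₂ <;> by_cases x ∈ C₃ <;> simp [*]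

end Counting

/-! ### Load bounds for fixed metadata -/

section Pointwise

variable {N B : ℕ} {α β : Type} [Fintype α] [Fintype β] {p : Library N B → α}
  {p' : Library N B → β} {A₁ A₂ A₃ C₁ C₂ C₃ : Finset (Fin N × Fin B)}

theorem load_ge_of_one (f : Fin N)
    (hA₁ : condEntropy (uniformLibrary N B) p (bits A₁) = 0)
    (hC₁ : condEntropy (uniformLibrary N B) p' (bits C₁) = 0) :
    ((row f \ A₁).card : ℝ) + (row f \ C₁).card ≤
      entropy (uniformLibrary N B) p + entropy (uniformLibrary N B) p' +
        (fileResidual p p' f A₁ + fileResidual p p' f C₁) := by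
  have h1 := entropy_ge_of_one (p := p) (f := f) hC₁
  have h2 := entropy_ge_of_one (p := p') (f := f) hA₁
  have := condEntropy_nonneg (uniformLibrary N B) p (bits (C₁ ∪ row f))
  have := condEntropy_nonneg (uniformLibrary N B) p' (bits (A₁ ∪ row f))
  rw [fileResidual_comm (p := p') (p' := p)] at h2
  linarith

/-- Here `A₁`, `C₁` are the actual caches and `A₂`, `C₂` virtual ones that decode `f₂` from the same
signals. A pair with a virtual cache covers `f₂` up to its residual, whereas `A₁`, `C₁` need only
decode `f₁`, so what they leave uncovered in `f₂` remains in the bound. The residual of `C₂` enters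
once through the entropies and twice through the pairs, whence the factor 3. -/
theorem load_ge_of_two {f₁ f₂ : Fin N} (h₂₁ : f₂ ≠ f₁)
    (hA₁ : condEntropy (uniformLibrary N B) p (bits A₁) = 0)
    (hA₂ : condEntropy (uniformLibrary N B) p (bits A₂) = 0)
    (hC₁ : condEntropy (uniformLibrary N B) p' (bits C₁) = 0)
    (hC₂ : condEntropy (uniformLibrary N B) p' (bits C₂) = 0) :
    ((row f₁ \ A₁).card : ℝ) + (row f₁ \ C₁).card +
      ((row f₂ \ A₁).card + (row f₂ \ A₂).card + (row f₂ \ C₁).card + (row f₂ \ C₂).card) ≤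
      entropy (uniformLibrary N B) p + entropy (uniformLibrary N B) p' + B +
        (fileResidual p p' f₁ A₁ + fileResidual p p' f₁ C₁ + (row f₂ \ (A₁ ∪ C₁)).card) +
        3 * fileResidual p p' f₂ A₂ + 3 * fileResidual p p' f₂ C₂ := by
  have h1 := entropy_ge_of_two (p := p) h₂₁ hC₁ hC₂
  have h2 := entropy_ge_of_two (p := p') h₂₁ hA₁ hA₂
  have := condEntropy_nonneg (uniformLibrary N B) p (bits (C₁ ∪ row f₁ ∪ C₂ ∪ row f₂))
  have := condEntropy_nonneg (uniformLibrary N B) p' (bits (A₁ ∪ row f₁ ∪ A₂ ∪ row f₂))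
  rw [fileResidual_comm (p := p') (p' := p), fileResidual_comm (p := p') (p' := p)] at h2
  have h3 := card_sdiff_two_le (row f₂) A₁ A₂ C₁ C₂
  rw [card_row] at h3
  have h3 : (_ : ℝ) ≤ _ := Nat.cast_le.2 h3
  push_cast at h3
  have := card_row_sdiff_le f₂ A₁ C₂ hA₁ hC₂
  have := card_row_sdiff_le f₂ A₂ C₂ hA₂ hC₂
  have := card_row_sdiff_le' f₂ A₂ C₁ hA₂ hC₁
  -- Pads the coefficient of the residual of `A₂` from 2 to 3, to match that of `C₂`.
  have := fileResidual_nonneg (p := p) (p' := p') f₂ A₂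
  linarith

/-- On `f₃`, pairs with `A₃` or `C₃` are controlled by residuals. The pairs left in the bound are
`(A₁, C₁)`, `(A₂, C₁)` and `(A₁, C₂)`. Each of them can be realized by one placement, so its
uncovered part will be small on average. -/
theorem load_ge_of_three {f₁ f₂ f₃ : Fin N} (h₂₁ : f₂ ≠ f₁) (h₃₁ : f₃ ≠ f₁) (h₃₂ : f₃ ≠ f₂)
    (hA₁ : condEntropy (uniformLibrary N B) p (bits A₁) = 0)
    (hA₂ : condEntropy (uniformLibrary N B) p (bits A₂) = 0)
    (hA₃ : condEntropy (uniformLibrary N B) p (bits A₃) = 0)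
    (hC₁ : condEntropy (uniformLibrary N B) p' (bits C₁) = 0)
    (hC₂ : condEntropy (uniformLibrary N B) p' (bits C₂) = 0)
    (hC₃ : condEntropy (uniformLibrary N B) p' (bits C₃) = 0) :
    ((row f₁ \ A₁).card : ℝ) + (row f₁ \ C₁).card +
      ((row f₂ \ A₁).card + (row f₂ \ A₂).card + (row f₂ \ C₁).card + (row f₂ \ C₂).card) +
      ((row f₃ \ A₁).card + (row f₃ \ A₂).card + (row f₃ \ A₃).card +
        (row f₃ \ C₁).card + (row f₃ \ C₂).card + (row f₃ \ C₃).card) ≤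
      entropy (uniformLibrary N B) p + entropy (uniformLibrary N B) p' + 3 * B +
        (fileResidual p p' f₁ A₁ + fileResidual p p' f₁ C₁ + (row f₂ \ (A₁ ∪ C₁)).card +
          (row f₃ \ (A₁ ∪ C₁)).card) +
        (3 * fileResidual p p' f₂ A₂ + (row f₃ \ (A₂ ∪ C₁)).card) +
        (3 * fileResidual p p' f₂ C₂ + (row f₃ \ (A₁ ∪ C₂)).card) +
        4 * fileResidual p p' f₃ A₃ + 4 * fileResidual p p' f₃ C₃ := by
  have h1 := entropy_ge_of_three (p := p) h₂₁ h₃₁ h₃₂ hC₁ hC₂ hC₃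
  have h2 := entropy_ge_of_three (p := p') h₂₁ h₃₁ h₃₂ hA₁ hA₂ hA₃
  simp only [fileResidual_comm (p := p') (p' := p)] at h2
  have h3 := card_sdiff_two_le (row f₂) A₁ A₂ C₁ C₂
  rw [card_row] at h3
  have h3 : (_ : ℝ) ≤ _ := Nat.cast_le.2 h3
  have h4 := card_sdiff_three_le (row f₃) A₁ A₂ A₃ C₁ C₂ C₃
  rw [card_row] at h4
  have h4 : (_ : ℝ) ≤ _ := Nat.cast_le.2 h4
  push_cast at h3 h4
  have := card_row_sdiff_le f₂ A₁ C₂ hA₁ hC₂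
  have := card_row_sdiff_le f₂ A₂ C₂ hA₂ hC₂
  have := card_row_sdiff_le' f₂ A₂ C₁ hA₂ hC₁
  have := card_row_sdiff_le f₃ A₁ C₃ hA₁ hC₃
  have := card_row_sdiff_le f₃ A₂ C₃ hA₂ hC₃
  have := card_row_sdiff_le f₃ A₃ C₃ hA₃ hC₃
  have := card_row_sdiff_le' f₃ A₃ C₁ hA₃ hC₁
  have := card_row_sdiff_le' f₃ A₃ C₂ hA₃ hC₂
  have := fileResidual_nonneg (p := p) (p' := p') f₂ A₂
  have := fileResidual_nonneg (p := p) (p' := p') f₃ A₃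
  linarith

end Pointwise

/-! ## Consequences of the constraints on a scheme -/

theorem pmf_prod_apply {α β : Type} (p : PMF α) (q : PMF β) (a : α) (b : β) :
    (p.bind fun a => q.map fun b => (a, b)) (a, b) = p a * q b := by
  classical
  rw [PMF.bind_apply, tsum_eq_single a]
  · rw [PMF.map_apply, tsum_eq_single b]
    · simp
    · intro b' hb
      simp [hb.symm]
  · intro a' ha
    rw [PMF.map_apply]
    simp [ha.symm]

theorem pmf_eq_of_toReal {α : Type} {p q : PMF α} (h : ∀ a, (p a).toReal = (q a).toReal) :
    p = q :=
  PMF.ext fun a => (ENNReal.toReal_eq_toReal_iff' (p.apply_ne_top a) (q.apply_ne_top a)).1 (h a)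

namespace CachingScheme

section Law

variable {K N B : ℕ} (s : CachingScheme K N B) (demandLaw : PMF (Demands K N))

/-- The joint law of the demands and the seed. -/
def choiceLaw : PMF (Demands K N × s.Seed) :=
  demandLaw.bind fun d => s.seedLaw.map fun w => (d, w)

theorem choiceLaw_toReal (d : Demands K N) (w : s.Seed) :
    (s.choiceLaw demandLaw (d, w)).toReal = (demandLaw d).toReal * (s.seedLaw w).toReal := by
  rw [choiceLaw, pmf_prod_apply, ENNReal.toReal_mul]

theorem law_toReal (F : Library N B) (θ : Demands K N × s.Seed) :
    (s.law demandLaw (F, θ)).toReal =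
      (uniformLibrary N B F).toReal * (s.choiceLaw demandLaw θ).toReal := by
  have : s.law demandLaw =
      (uniformLibrary N B).bind fun F => (s.choiceLaw demandLaw).map fun θ => (F, θ) := by
    simp only [law, choiceLaw, PMF.map_bind, PMF.map_comp]
    rfl
  rw [this, pmf_prod_apply, ENNReal.toReal_mul]

theorem pr_law_of_demand {τ : Type} (X : s.Sample → τ) {x : τ} {d : Demands K N}
    (h : ∀ ω, X ω = x → ω.2.1 = d) :
    pr (s.law demandLaw) X x = (demandLaw d).toReal *
      ∑ F, (uniformLibrary N B F).toReal * pr s.seedLaw (fun w => X (F, d, w)) x := by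
  classical
  simp_rw [pr_eq_sum]
  rw [Fintype.sum_prod_type, Finset.mul_sum]
  simp_rw [Fintype.sum_prod_type, law_toReal, choiceLaw_toReal]
  refine Finset.sum_congr rfl fun F _ => ?_
  rw [Finset.sum_eq_single d]
  · simp_rw [Finset.mul_sum, mul_ite, mul_zero, mul_left_comm]
  · intro d' _ hd
    exact Finset.sum_eq_zero fun w _ => if_neg fun hx => hd (h (F, d', w) hx.symm)
  · simp

theorem pr_law_of_demand_of_meta {τ : Type} (X : Demands K N → s.Seed → τ) {x : τ}
    {d : Demands K N} (h : ∀ d' w, X d' w = x → d' = d) :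
    pr (s.law demandLaw) (fun ω => X ω.2.1 ω.2.2) x =
      (demandLaw d).toReal * pr s.seedLaw (X d) x := by
  refine (pr_law_of_demand s demandLaw _ fun ω => h ω.2.1 ω.2.2).trans ?_
  dsimp only
  rw [← Finset.sum_mul, pmf_sum_toReal, one_mul]

theorem pr_demands_demand (k : Fin K) (d : Demands K N) :
    pr (s.law demandLaw) (fun ω => (s.demands ω, s.demand k ω)) (d, d k) =
      (demandLaw d).toReal := by
  refine (pr_law_of_demand_of_meta s demandLaw (fun d _ => (d, d k))
    fun d' w h => (Prod.mk.inj h).1).trans ?_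
  rw [pr_eq_sum]
  simp [pmf_sum_toReal]

variable {s demandLaw}

/-- The metadata are a function of the signals and the cache, so they inherit the vanishing mutual
information. Conditional independence then says that their law given `d` depends on `d k` only. Full
support of the demands allows the division by the probability of `d`. -/
theorem map_meta_eq_of_privacy (hfull : ∀ d, demandLaw d ≠ 0) {k : Fin K}
    (h : condMutualInfo (s.law demandLaw) s.demands
      (fun ω => (s.signals ω, s.cache k ω)) (s.demand k) = 0)
    {d d' : Demands K N} (hd : d k = d' k) :
    s.seedLaw.map (fun w => (s.txMeta w d, s.cacheMeta w k)) =
      s.seedLaw.map (fun w => (s.txMeta w d', s.cacheMeta w k)) := by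
  set T : Demands K N → s.Seed → (Fin K → s.TxMeta) × s.CacheMeta :=
    fun d w => (s.txMeta w d, s.cacheMeta w k) with hT
  have h0 : condMutualInfo (s.law demandLaw) s.demands (fun ω => T ω.2.1 ω.2.2) (s.demand k) =
      0 := by
    refine le_antisymm ?_ (condMutualInfo_nonneg_and_eq_zero_iff _ _ _ _).1
    rw [← h]
    refine sub_le_sub_left (condEntropy_le_of_determined _ _ fun ω ω' h => ?_) _
    simp only [Prod.mk.injEq, signals, cache, signal, packetMeta, funext_iff] at h
    simp only [hT, Prod.mk.injEq, funext_iff]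
    exact ⟨⟨fun k => (h.1.1 k).1, h.1.2.1⟩, h.2⟩
  have h1 := (condMutualInfo_nonneg_and_eq_zero_iff _ _ _ _).2.1 h0
  have hpos : ∀ d, 0 < (demandLaw d).toReal := fun d =>
    ENNReal.toReal_pos (hfull d) (demandLaw.apply_ne_top d)
  have h2 : ∀ d t, pr s.seedLaw (T d) t * pr (s.law demandLaw) (s.demand k) (d k) =
      pr (s.law demandLaw) (fun ω => (T ω.2.1 ω.2.2, s.demand k ω)) (t, d k) := by
    intro d t
    have h3 := h1 d t (d k)
    have e1 : pr (s.law demandLaw) (fun ω => (s.demands ω, T ω.2.1 ω.2.2, s.demand k ω))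
        (d, t, d k) = (demandLaw d).toReal * pr s.seedLaw (T d) t := by
      refine (pr_law_of_demand_of_meta s demandLaw (fun d w => (d, T d w, d k))
        fun d' w h => (Prod.mk.inj h).1).trans ?_
      congr 1
      exact le_antisymm (pr_mono _ fun ω h => (Prod.mk.inj (Prod.mk.inj h).2).1)
        (pr_mono _ fun ω h => by rw [h])
    rw [e1, pr_demands_demand, mul_assoc] at h3
    exact mul_left_cancel₀ (hpos d).ne' h3
  have h3 : 0 < pr (s.law demandLaw) (s.demand k) (d k) := by
    refine lt_of_lt_of_le (hpos d) ?_
    rw [← pr_demands_demand s demandLaw k d]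
    exact pr_mono _ fun ω h => (Prod.mk.inj h).2
  refine pmf_eq_of_toReal fun t => mul_right_cancel₀ h3.ne' ?_
  refine (h2 d t).trans ?_
  rw [hd]
  exact (h2 d' t).symm

/-- A vanishing average of nonnegative conditional entropies vanishes at each demand vector and seed
of positive probability. -/
theorem condEntropy_payload_eq_zero (hfull : ∀ d, demandLaw d ≠ 0) {k : Fin K}
    {S : s.CacheMeta → Finset (Fin N × Fin B)}
    (hS : ∀ m F F', s.content k m F = s.content k m F' ↔ bits (S m) F = bits (S m) F')
    (h : condEntropy (s.law demandLaw) (s.signal k)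
      (fun ω => (s.packetMeta k ω, s.cache k ω)) = 0)
    (d : Demands K N) {w : s.Seed} (hw : s.seedLaw w ≠ 0) :
    condEntropy (uniformLibrary N B) (s.payload k (s.txMeta w d k))
      (bits (S (s.cacheMeta w k))) = 0 := by
  have h1 := sum_condEntropy_le (s.law_toReal demandLaw) (s.signal k)
    (fun ω => (s.packetMeta k ω, s.cache k ω))
  rw [h] at h1
  have h2 := (Finset.sum_eq_zero_iff_of_nonneg fun θ _ => mul_nonneg ENNReal.toReal_nonneg
    (condEntropy_nonneg _ _ _)).1 (h1.antisymm (Finset.sum_nonneg fun θ _ =>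
      mul_nonneg ENNReal.toReal_nonneg (condEntropy_nonneg _ _ _))) (d, w) (Finset.mem_univ _)
  rw [choiceLaw_toReal] at h2
  have hd := ENNReal.toReal_pos (hfull d) (demandLaw.apply_ne_top d)
  have hw := ENNReal.toReal_pos hw (s.seedLaw.apply_ne_top w)
  rw [← (mul_eq_zero.1 h2).resolve_left (by positivity)]
  refine condEntropy_congr _ (fun F F' _ => ?_) fun F F' => ?_
  · simp [signal, packetMeta]
  · simp [packetMeta, cache, hS]

theorem sum_card_le_of_memory {k : Fin K} {S : s.CacheMeta → Finset (Fin N × Fin B)}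
    (hS : ∀ m F F', s.content k m F = s.content k m F' ↔ bits (S m) F = bits (S m) F') :
    ∑ w, (s.seedLaw w).toReal * ((S (s.cacheMeta w k)).card : ℝ) ≤
      entropy (s.law demandLaw) (s.cache k) := by
  refine le_trans (le_of_eq ?_) (sum_entropy_le (s.law_toReal demandLaw) (s.cache k))
  rw [Fintype.sum_prod_type]
  simp_rw [choiceLaw_toReal]
  have : ∀ d w, entropy (uniformLibrary N B) (fun F => s.cache k (F, d, w)) =
      (S (s.cacheMeta w k)).card := by
    intro d w
    rw [← entropy_bits]
    refine entropy_congr _ fun F F' => ?_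
    simp [cache, hS]
  simp_rw [this, mul_assoc, ← Finset.mul_sum, ← Finset.sum_mul, pmf_sum_toReal, one_mul]

end Law

section TwoUsers

variable {N B : ℕ} {s : CachingScheme 2 N B} {demandLaw : PMF (Demands 2 N)}

/-- The residual uncertainty on file `j` under given metadata. -/
def metaResidual (s : CachingScheme 2 N B) (q : Fin 2 → s.TxMeta) (j : Fin N)
    (C : Finset (Fin N × Fin B)) : ℝ :=
  fileResidual (s.payload 0 (q 0)) (s.payload 1 (q 1)) j C

/-- The total length of the packets under given metadata. -/
def metaLoad (s : CachingScheme 2 N B) (q : Fin 2 → s.TxMeta) : ℝ :=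
  entropy (uniformLibrary N B) (s.payload 0 (q 0)) +
    entropy (uniformLibrary N B) (s.payload 1 (q 1))

/-- Revealing demands and seed only lowers the decoding uncertainty. Of the resulting average, the
terms of the single demand vector `d` are kept. -/
theorem sum_metaResidual_le {k : Fin 2} {S : s.CacheMeta → Finset (Fin N × Fin B)}
    (hS : ∀ m F F', s.content k m F = s.content k m F' ↔ bits (S m) F = bits (S m) F')
    (d : Demands 2 N) :
    (demandLaw d).toReal * ∑ w, (s.seedLaw w).toReal *
      s.metaResidual (s.txMeta w d) (d k) (S (s.cacheMeta w k)) ≤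
      condEntropy (s.law demandLaw) (s.demandedFile k)
        (fun ω => (s.signals ω, s.cache k ω, s.demand k ω)) := by
  refine le_trans ?_ (sum_condEntropy_le (s.law_toReal demandLaw) _ _)
  rw [Fintype.sum_prod_type]
  refine le_trans (le_of_eq ?_) (Finset.single_le_sum (fun d _ => Finset.sum_nonneg fun w _ =>
    mul_nonneg ENNReal.toReal_nonneg (condEntropy_nonneg _ _ _)) (Finset.mem_univ d))
  rw [Finset.mul_sum]
  refine Finset.sum_congr rfl fun w _ => ?_
  rw [choiceLaw_toReal, mul_assoc]
  congr 2
  refine condEntropy_congr _ (fun F F' _ => ?_) fun F F' => ?_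
  · rw [bits_eq_iff]
    simp only [mem_row, demandedFile, funext_iff]
    constructor
    · intro h b
      exact h (d k, b) rfl
    · rintro h ⟨i, b⟩ rfl
      exact h b
  · simp [cache, hS, signals, signal, packetMeta, demand, funext_iff, Fin.forall_fin_two]

/-- Privacy makes the mean load independent of the demands: passing from `d'` to `![d' 0, d 1]` is
hidden from user 0, and from there to `d` from user 1. The load constraint, an average over demands,
therefore holds for each demand vector. -/
theorem sum_metaLoad_le (hpriv : ∀ (k : Fin 2) (d d' : Demands 2 N), d k = d' k →
      s.seedLaw.map (fun w => (s.txMeta w d, s.cacheMeta w k)) =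
        s.seedLaw.map (fun w => (s.txMeta w d', s.cacheMeta w k))) (d : Demands 2 N) :
    ∑ w, (s.seedLaw w).toReal * s.metaLoad (s.txMeta w d) ≤
      ∑ k, entropy (s.law demandLaw) (s.signal k) := by
  have h1 : ∀ (k : Fin 2) (d d' : Demands 2 N), d k = d' k →
      ∑ w, (s.seedLaw w).toReal * s.metaLoad (s.txMeta w d) =
        ∑ w, (s.seedLaw w).toReal * s.metaLoad (s.txMeta w d') := fun k d d' h =>
    sum_mul_congr_of_map_eq s.seedLaw (hpriv k d d' h) (fun t => s.metaLoad t.1)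
  have h2 : ∀ d', ∑ w, (s.seedLaw w).toReal * s.metaLoad (s.txMeta w d') =
      ∑ w, (s.seedLaw w).toReal * s.metaLoad (s.txMeta w d) := fun d' =>
    (h1 0 d' ![d' 0, d 1] rfl).trans (h1 1 _ d rfl)
  have h3 : ∑ d', (demandLaw d').toReal *
      ∑ w, (s.seedLaw w).toReal * s.metaLoad (s.txMeta w d') =
        ∑ w, (s.seedLaw w).toReal * s.metaLoad (s.txMeta w d) := by
    simp_rw [h2, ← Finset.sum_mul, pmf_sum_toReal, one_mul]
  rw [← h3, Fin.sum_univ_two]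
  refine le_trans (le_of_eq ?_) (add_le_add (sum_entropy_le (s.law_toReal demandLaw) _)
    (sum_entropy_le (s.law_toReal demandLaw) _))
  rw [Fintype.sum_prod_type, Fintype.sum_prod_type, ← Finset.sum_add_distrib]
  refine Finset.sum_congr rfl fun d' _ => ?_
  rw [Finset.mul_sum, ← Finset.sum_add_distrib]
  refine Finset.sum_congr rfl fun w _ => ?_
  rw [choiceLaw_toReal, metaLoad, ← mul_add, mul_assoc]
  congr 3
  · exact entropy_congr _ fun F F' => by simp [signal, packetMeta]
  · exact entropy_congr _ fun F F' => by simp [signal, packetMeta]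

end TwoUsers
end CachingScheme

/-! ## The converse bound -/

section Average

variable {Θ α : Type} [Fintype Θ] (v : PMF Θ)

/-- The average of a real function under a finite law. -/
def avg (g : Θ → ℝ) : ℝ := ∑ w, (v w).toReal * g w

theorem avg_add (g h : Θ → ℝ) : avg v (fun w => g w + h w) = avg v g + avg v h := by
  simp only [avg, mul_add, Finset.sum_add_distrib]

theorem avg_sub (g h : Θ → ℝ) : avg v (fun w => g w - h w) = avg v g - avg v h := by
  simp only [avg, mul_sub, Finset.sum_sub_distrib]

theorem avg_const_mul (c : ℝ) (g : Θ → ℝ) : avg v (fun w => c * g w) = c * avg v g := by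
  simp only [avg, Finset.mul_sum, mul_left_comm]

theorem avg_const (c : ℝ) : avg v (fun _ => c) = c := by
  rw [avg, ← Finset.sum_mul, pmf_sum_toReal, one_mul]

theorem avg_mono {g h : Θ → ℝ} (hgh : ∀ w, v w ≠ 0 → g w ≤ h w) : avg v g ≤ avg v h := by
  refine Finset.sum_le_sum fun w _ => ?_
  rcases eq_or_ne (v w) 0 with h0 | h0
  · simp [h0]
  · exact mul_le_mul_of_nonneg_left (hgh w h0) ENNReal.toReal_nonneg

theorem avg_sum {ι : Type} [Fintype ι] (g : ι → Θ → ℝ) :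
    avg v (fun w => ∑ i, g i w) = ∑ i, avg v (g i) := by
  simp only [avg, Finset.mul_sum]
  exact Finset.sum_comm

/-- If `X` and `X'` have the same law, each value of `X'` can be completed to a sample at which `X`
takes this value, such that a given cost does not increase on average. -/
theorem exists_resample [Fintype α] {X X' : Θ → α} (h : v.map X = v.map X') (φ : α → Θ → ℝ) :
    ∃ σ : Θ → Θ, (∀ w, v w ≠ 0 → v (σ w) ≠ 0 ∧ X (σ w) = X' w) ∧
      avg v (fun w => φ (X' w) (σ w)) ≤ avg v (fun w => φ (X w) w) := by
  classical
  -- On the fibre over `x` a sample of least cost is chosen, so its cost is at most the conditional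
  -- mean. Values of probability zero get an arbitrary sample.
  have key : ∀ x, ∃ w₀, ∀ w, v w ≠ 0 → X w = x →
      v w₀ ≠ 0 ∧ X w₀ = x ∧ φ x w₀ ≤ φ x w := by
    intro x
    by_cases hx : ∃ w, v w ≠ 0 ∧ X w = x
    · obtain ⟨w₁, h₁⟩ := hx
      obtain ⟨w₀, h₀, hmin⟩ := Finset.exists_min_image
        (Finset.univ.filter fun w => v w ≠ 0 ∧ X w = x) (φ x) ⟨w₁, by simpa using h₁⟩
      simp only [Finset.mem_filter, Finset.mem_univ, true_and] at h₀ hmin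
      exact ⟨w₀, fun w hw hwx => ⟨h₀.1, h₀.2, hmin w ⟨hw, hwx⟩⟩⟩
    · obtain ⟨w₁, _⟩ := v.support_nonempty
      exact ⟨w₁, fun w hw hwx => absurd ⟨w, hw, hwx⟩ hx⟩
  choose τ hτ using key
  refine ⟨fun w => τ (X' w), fun w hw => ?_, ?_⟩
  · have hmem : X' w ∈ (v.map X).support := by
      rw [h, PMF.support_map]
      exact ⟨w, hw, rfl⟩
    rw [PMF.support_map] at hmem
    obtain ⟨w', hw', hX⟩ := hmem
    have := hτ (X' w) w' hw' hX
    exact ⟨this.1, this.2.1⟩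
  · refine (sum_mul_congr_of_map_eq v h (fun x => φ x (τ x))).symm.le.trans ?_
    exact avg_mono v fun w hw => (hτ (X w) w hw rfl).2.2

end Average

namespace CachingScheme

/-- What the constraints on a scheme for two users with uncoded placement amount to on the level of
the metadata: under metadata `m`, user `k` caches the bits at the positions `S k m`. -/
structure IsPrivateUncoded {N B : ℕ} (s : CachingScheme 2 N B)
    (S : Fin 2 → s.CacheMeta → Finset (Fin N × Fin B)) (η L : ℝ) : Prop where
  encoding : ∀ (k : Fin 2) (d : Demands 2 N) (w : s.Seed), s.seedLaw w ≠ 0 →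
    condEntropy (uniformLibrary N B) (s.payload k (s.txMeta w d k))
      (bits (S k (s.cacheMeta w k))) = 0
  decoding : ∀ (k : Fin 2) (d : Demands 2 N),
    avg s.seedLaw (fun w => s.metaResidual (s.txMeta w d) (d k) (S k (s.cacheMeta w k))) ≤ η
  privacy : ∀ (k : Fin 2) (d d' : Demands 2 N), d k = d' k →
    s.seedLaw.map (fun w => (s.txMeta w d, s.cacheMeta w k)) =
      s.seedLaw.map (fun w => (s.txMeta w d', s.cacheMeta w k))
  load : ∀ d : Demands 2 N, avg s.seedLaw (fun w => s.metaLoad (s.txMeta w d)) ≤ L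

variable {N B : ℕ} {s : CachingScheme 2 N B} {S : Fin 2 → s.CacheMeta → Finset (Fin N × Fin B)}
  {η L : ℝ}

variable (s S) in
/-- The average number of bits of file `j` that user `k` does not cache. -/
def uncached (k : Fin 2) (j : Fin N) : ℝ :=
  avg s.seedLaw fun w => ((row j \ S k (s.cacheMeta w k)).card : ℝ)

namespace IsPrivateUncoded

variable (h : s.IsPrivateUncoded S η L)
include h

theorem encoding_of_eq (k : Fin 2) {d : Demands 2 N} {w : s.Seed} (hw : s.seedLaw w ≠ 0)
    {q : Fin 2 → s.TxMeta} (hq : s.txMeta w d = q) :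
    condEntropy (uniformLibrary N B) (s.payload k (q k)) (bits (S k (s.cacheMeta w k))) = 0 :=
  hq ▸ h.encoding k d w hw

/-- The placement ignores the demands, so file `j` may be assumed to be demanded by both users. -/
theorem avg_uncovered_le (j : Fin N) :
    avg s.seedLaw (fun w =>
      ((row j \ (S 0 (s.cacheMeta w 0) ∪ S 1 (s.cacheMeta w 1))).card : ℝ)) ≤ η :=
  (avg_mono s.seedLaw fun w hw =>
    card_row_sdiff_le j _ _ (h.encoding 0 ![j, j] w hw) (h.encoding 1 ![j, j] w hw)).trans
      (h.decoding 1 ![j, j])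

theorem load_ge_one_file (f : Fin N) :
    uncached s S 0 f + uncached s S 1 f ≤ L + 2 * η := by
  have key := avg_mono s.seedLaw fun w hw =>
    load_ge_of_one f (h.encoding 0 ![f, f] w hw) (h.encoding 1 ![f, f] w hw)
  simp only [avg_add] at key
  have h1 := h.load ![f, f]
  have h2 := h.decoding 0 ![f, f]
  have h3 := h.decoding 1 ![f, f]
  simp only [metaLoad, avg_add] at h1
  simp only [metaResidual, Matrix.cons_val_zero, Matrix.cons_val_one] at h2 h3
  simp only [uncached]
  linarith

theorem load_ge_two_files {f₁ f₂ : Fin N} (h₂₁ : f₂ ≠ f₁) :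
    uncached s S 0 f₁ + uncached s S 1 f₁ + 2 * (uncached s S 0 f₂ + uncached s S 1 f₂) ≤
      L + B + 9 * η := by
  -- The seed `σ₂ w` supplies the virtual cache `A₂`. One sample has to make the residual small and
  -- the number of missing bits large at once, so both enter a single cost, with the coefficients of
  -- `load_ge_of_two`.
  obtain ⟨σ₂, hσ₂, e₂⟩ := exists_resample s.seedLaw (h.privacy 1 ![f₂, f₁] ![f₁, f₁] rfl)
    fun x w => 3 * s.metaResidual x.1 f₂ (S 0 (s.cacheMeta w 0)) -
      ((row f₂ \ S 0 (s.cacheMeta w 0)).card : ℝ)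
  obtain ⟨τ₂, hτ₂, t₂⟩ := exists_resample s.seedLaw (h.privacy 0 ![f₁, f₂] ![f₁, f₁] rfl)
    fun x w => 3 * s.metaResidual x.1 f₂ (S 1 (s.cacheMeta w 1)) -
      ((row f₂ \ S 1 (s.cacheMeta w 1)).card : ℝ)
  have key := avg_mono s.seedLaw fun w hw =>
    load_ge_of_two h₂₁ (h.encoding 0 ![f₁, f₁] w hw)
      (h.encoding_of_eq 0 (hσ₂ w hw).1 (Prod.mk.inj (hσ₂ w hw).2).1)
      (h.encoding 1 ![f₁, f₁] w hw)
      (h.encoding_of_eq 1 (hτ₂ w hw).1 (Prod.mk.inj (hτ₂ w hw).2).1)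
  simp only [avg_add, avg_const_mul, avg_const] at key
  have h1 := h.load ![f₁, f₁]
  have h2 := h.decoding 0 ![f₁, f₁]
  have h3 := h.decoding 1 ![f₁, f₁]
  have h4 := h.decoding 0 ![f₂, f₁]
  have h5 := h.decoding 1 ![f₁, f₂]
  have h6 := h.avg_uncovered_le f₂
  simp only [metaLoad, avg_add] at h1
  simp only [metaResidual, Matrix.cons_val_zero, Matrix.cons_val_one, avg_sub, avg_const_mul]
    at h2 h3 h4 h5 e₂ t₂
  simp only [uncached]
  linarith

theorem load_ge_three_files {f₁ f₂ f₃ : Fin N} (h₂₁ : f₂ ≠ f₁) (h₃₁ : f₃ ≠ f₁) (h₃₂ : f₃ ≠ f₂) :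
    uncached s S 0 f₁ + uncached s S 1 f₁ + 2 * (uncached s S 0 f₂ + uncached s S 1 f₂) +
      3 * (uncached s S 0 f₃ + uncached s S 1 f₃) ≤ L + 3 * B + 20 * η := by
  -- The cost now also counts the missing bits of `f₃`. As `x.2` is the cache metadata of user 1,
  -- the second term becomes the uncovered part of the pair `(A₂, C₁)` after resampling, while
  -- before resampling it concerns the two actual caches, where `avg_uncovered_le` bounds its mean.
  obtain ⟨σ₂, hσ₂, e₂⟩ := exists_resample s.seedLaw (h.privacy 1 ![f₂, f₁] ![f₁, f₁] rfl)
    fun x w => 3 * s.metaResidual x.1 f₂ (S 0 (s.cacheMeta w 0)) +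
      ((row f₃ \ (S 0 (s.cacheMeta w 0) ∪ S 1 x.2)).card : ℝ) -
      ((row f₂ \ S 0 (s.cacheMeta w 0)).card : ℝ) - ((row f₃ \ S 0 (s.cacheMeta w 0)).card : ℝ)
  obtain ⟨τ₂, hτ₂, t₂⟩ := exists_resample s.seedLaw (h.privacy 0 ![f₁, f₂] ![f₁, f₁] rfl)
    fun x w => 3 * s.metaResidual x.1 f₂ (S 1 (s.cacheMeta w 1)) +
      ((row f₃ \ (S 0 x.2 ∪ S 1 (s.cacheMeta w 1))).card : ℝ) -
      ((row f₂ \ S 1 (s.cacheMeta w 1)).card : ℝ) - ((row f₃ \ S 1 (s.cacheMeta w 1)).card : ℝ)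
  obtain ⟨σ₃, hσ₃, e₃⟩ := exists_resample s.seedLaw (h.privacy 1 ![f₃, f₁] ![f₁, f₁] rfl)
    fun x w => 4 * s.metaResidual x.1 f₃ (S 0 (s.cacheMeta w 0)) -
      ((row f₃ \ S 0 (s.cacheMeta w 0)).card : ℝ)
  obtain ⟨τ₃, hτ₃, t₃⟩ := exists_resample s.seedLaw (h.privacy 0 ![f₁, f₃] ![f₁, f₁] rfl)
    fun x w => 4 * s.metaResidual x.1 f₃ (S 1 (s.cacheMeta w 1)) -
      ((row f₃ \ S 1 (s.cacheMeta w 1)).card : ℝ)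
  have key := avg_mono s.seedLaw fun w hw =>
    load_ge_of_three h₂₁ h₃₁ h₃₂ (h.encoding 0 ![f₁, f₁] w hw)
      (h.encoding_of_eq 0 (hσ₂ w hw).1 (Prod.mk.inj (hσ₂ w hw).2).1)
      (h.encoding_of_eq 0 (hσ₃ w hw).1 (Prod.mk.inj (hσ₃ w hw).2).1)
      (h.encoding 1 ![f₁, f₁] w hw)
      (h.encoding_of_eq 1 (hτ₂ w hw).1 (Prod.mk.inj (hτ₂ w hw).2).1)
      (h.encoding_of_eq 1 (hτ₃ w hw).1 (Prod.mk.inj (hτ₃ w hw).2).1)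
  simp only [avg_add, avg_const_mul, avg_const] at key
  have h1 := h.load ![f₁, f₁]
  have h2 := h.decoding 0 ![f₁, f₁]
  have h3 := h.decoding 1 ![f₁, f₁]
  have h4 := h.decoding 0 ![f₂, f₁]
  have h5 := h.decoding 1 ![f₁, f₂]
  have h6 := h.avg_uncovered_le f₂
  have h7 := h.avg_uncovered_le f₃
  have h8 := h.decoding 0 ![f₃, f₁]
  have h9 := h.decoding 1 ![f₁, f₃]
  simp only [metaLoad, avg_add] at h1
  simp only [metaResidual, Matrix.cons_val_zero, Matrix.cons_val_one, avg_add, avg_sub,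
    avg_const_mul] at h2 h3 h4 h5 h8 h9 e₂ t₂ e₃ t₃
  simp only [uncached]
  linarith

end IsPrivateUncoded

theorem sum_uncached (k : Fin 2) :
    ∑ j, uncached s S k j =
      N * B - avg s.seedLaw (fun w => ((S k (s.cacheMeta w k)).card : ℝ)) := by
  simp only [uncached]
  rw [← avg_sum, ← avg_const s.seedLaw ((N : ℝ) * B), ← avg_sub]
  congr 1
  funext w
  set T := S k (s.cacheMeta w k)
  have h : ∑ j : Fin N, (row j \ T).card = Tᶜ.card := by
    rw [Finset.card_eq_sum_card_fiberwise (f := Prod.fst) (t := Finset.univ) (by simp)]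
    refine Finset.sum_congr rfl fun j _ => congrArg _ ?_
    ext x
    simp [mem_row, and_comm]
  have h' : T.card + Tᶜ.card = N * B := by
    rw [Finset.card_add_card_compl]
    simp
  rw [← Nat.cast_sum, h, eq_sub_iff_add_eq]
  exact_mod_cast (add_comm _ _).trans h'

theorem IsUncoded.exists_finset {K : ℕ} {s : CachingScheme K N B} (h : s.IsUncoded) :
    ∃ S : Fin K → s.CacheMeta → Finset (Fin N × Fin B), ∀ k m F F',
      s.content k m F = s.content k m F' ↔ bits (S k m) F = bits (S k m) F' := by
  classical
  choose S hS using h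
  refine ⟨fun k m => (S k m).toFinset, fun k m F F' => ?_⟩
  rw [hS, bits_eq_iff]
  simp

/-- The constraint on the number of bits that the users do not cache, and the bounds on the load in
terms of these numbers. -/
theorem IsValid.exists_bounds {demandLaw : PMF (Demands 2 N)} (hfull : ∀ d, demandLaw d ≠ 0)
    {M R ε : ℝ} (hv : s.IsValid demandLaw M R ε) (hu : s.IsUncoded) :
    ∃ x : Fin N → ℝ, 2 * (B * (N - M - ε)) ≤ ∑ j, x j ∧
      (∀ f, x f ≤ B * (R + ε) + 2 * (B * ε * ∑ d, ((demandLaw d).toReal)⁻¹)) ∧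
      (∀ f₁ f₂, f₂ ≠ f₁ → x f₁ + 2 * x f₂ ≤
        B * (R + ε) + B + 9 * (B * ε * ∑ d, ((demandLaw d).toReal)⁻¹)) ∧
      ∀ f₁ f₂ f₃, f₂ ≠ f₁ → f₃ ≠ f₁ → f₃ ≠ f₂ → x f₁ + 2 * x f₂ + 3 * x f₃ ≤
        B * (R + ε) + 3 * B + 20 * (B * ε * ∑ d, ((demandLaw d).toReal)⁻¹) := by
  obtain ⟨S, hS⟩ := hu.exists_finset
  have hpriv : ∀ (k : Fin 2) (d d' : Demands 2 N), d k = d' k →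
      s.seedLaw.map (fun w => (s.txMeta w d, s.cacheMeta w k)) =
        s.seedLaw.map (fun w => (s.txMeta w d', s.cacheMeta w k)) :=
    fun k d d' h => map_meta_eq_of_privacy hfull (hv.privacy k) h
  have h : s.IsPrivateUncoded S (B * ε * ∑ d, ((demandLaw d).toReal)⁻¹) (B * (R + ε)) := by
    refine ⟨fun k d w hw => condEntropy_payload_eq_zero hfull (hS k) (hv.encoding k) d hw,
      fun k d => ?_, hpriv, fun d => (sum_metaLoad_le hpriv d).trans hv.load⟩
    have h0 := ENNReal.toReal_pos (hfull d) (demandLaw.apply_ne_top d)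
    have h1 := (sum_metaResidual_le (demandLaw := demandLaw) (hS k) d).trans (hv.decoding k)
    have h2 := h1
    -- Fixing the demand vector costs a factor `1 / P(d)`. The sum of all these inverses serves
    -- every `d` and does not depend on `B`.
    rw [mul_comm, ← le_div_iff₀ h0, div_eq_mul_inv] at h1
    refine h1.trans (mul_le_mul_of_nonneg_left ?_ ?_)
    · exact Finset.single_le_sum (f := fun d => ((demandLaw d).toReal)⁻¹)
        (fun d _ => by positivity) (Finset.mem_univ d)
    -- The sign of `B * ε` is read off from the decoding bound, whose left side is nonnegative.
    · refine le_trans (mul_nonneg h0.le (Finset.sum_nonneg fun w _ =>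
        mul_nonneg ENNReal.toReal_nonneg (condEntropy_nonneg _ _ _))) h2
  refine ⟨fun j => uncached s S 0 j + uncached s S 1 j, ?_, h.load_ge_one_file,
    fun f₁ f₂ h₁ => h.load_ge_two_files h₁,
    fun f₁ f₂ f₃ h₁ h₂ h₃ => h.load_ge_three_files h₁ h₂ h₃⟩
  have h0 := (sum_card_le_of_memory (demandLaw := demandLaw) (hS 0)).trans (hv.memory 0)
  have h1 := (sum_card_le_of_memory (demandLaw := demandLaw) (hS 1)).trans (hv.memory 1)
  rw [Finset.sum_add_distrib, sum_uncached, sum_uncached]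
  simp only [avg]
  linarith

end CachingScheme

/-! ### The converse for two and three files -/

theorem le_of_achievable_uncoded {N : ℕ} {demandLaw : PMF (Demands 2 N)} {M R r C : ℝ}
    (h : Achievable (UncodedPlacement 2 N) demandLaw M R)
    (hr : ∀ (B : ℕ) (s : CachingScheme 2 N B) (ε : ℝ), 0 < B → s.IsUncoded →
      s.IsValid demandLaw M R ε → (B : ℝ) * r ≤ B * (R + C * ε)) : r ≤ R := by
  obtain ⟨ε, _, hlim, hev⟩ := h
  have h1 : Tendsto (fun B => R + C * ε B) atTop (𝓝 (R + C * 0)) :=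
    tendsto_const_nhds.add (hlim.const_mul C)
  rw [mul_zero, add_zero] at h1
  refine ge_of_tendsto h1 ?_
  filter_upwards [hev, eventually_gt_atTop 0] with B hB hpos
  obtain ⟨s, hs, hvalid⟩ := hB
  exact le_of_mul_le_mul_left (hr B s (ε B) hpos hs hvalid) (by exact_mod_cast hpos)

/-- Each bound on the numbers of missing bits is summed over the cyclic shifts of the files and
compared with the memory constraint. The constant `C` collects the coefficients of `ε` from memory,
load and decoding. -/
theorem converse_two_files {demandLaw : PMF (Demands 2 2)} (hfull : ∀ d, demandLaw d ≠ 0)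
    {M R : ℝ} (h : Achievable (UncodedPlacement 2 2) demandLaw M R) :
    5 - 3 * M ≤ R ∧ 2 - M ≤ R := by
  set c := ∑ d, ((demandLaw d).toReal)⁻¹ with hc
  constructor
  · refine le_of_achievable_uncoded (C := 4 + 9 * c) h fun B s ε _ hu hv => ?_
    obtain ⟨x, h0, -, h2, -⟩ := hv.exists_bounds hfull hu
    have := h2 0 1 (by decide)
    have := h2 1 0 (by decide)
    rw [Fin.sum_univ_two] at h0
    push_cast at h0
    linarith
  · refine le_of_achievable_uncoded (C := 2 + 2 * c) h fun B s ε _ hu hv => ?_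
    obtain ⟨x, h0, h1, -, -⟩ := hv.exists_bounds hfull hu
    have := h1 0
    have := h1 1
    rw [Fin.sum_univ_two] at h0
    push_cast at h0
    linarith

theorem converse_three_files {demandLaw : PMF (Demands 2 3)} (hfull : ∀ d, demandLaw d ≠ 0)
    {M R : ℝ} (h : Achievable (UncodedPlacement 2 3) demandLaw M R) :
    9 - 4 * M ≤ R ∧ 5 - 2 * M ≤ R ∧ 2 - 2 / 3 * M ≤ R := by
  set c := ∑ d, ((demandLaw d).toReal)⁻¹ with hc
  refine ⟨?_, ?_, ?_⟩
  · refine le_of_achievable_uncoded (C := 5 + 20 * c) h fun B s ε _ hu hv => ?_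
    obtain ⟨x, h0, -, -, h3⟩ := hv.exists_bounds hfull hu
    have := h3 0 1 2 (by decide) (by decide) (by decide)
    have := h3 1 2 0 (by decide) (by decide) (by decide)
    have := h3 2 0 1 (by decide) (by decide) (by decide)
    rw [Fin.sum_univ_three] at h0
    push_cast at h0
    linarith
  · refine le_of_achievable_uncoded (C := 3 + 9 * c) h fun B s ε _ hu hv => ?_
    obtain ⟨x, h0, -, h2, -⟩ := hv.exists_bounds hfull hu
    have := h2 0 1 (by decide)
    have := h2 1 2 (by decide)
    have := h2 2 0 (by decide)
    rw [Fin.sum_univ_three] at h0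
    push_cast at h0
    linarith
  · refine le_of_achievable_uncoded (C := 5 / 3 + 2 * c) h fun B s ε _ hu hv => ?_
    obtain ⟨x, h0, h1, -, -⟩ := hv.exists_bounds hfull hu
    have := h1 0
    have := h1 1
    have := h1 2
    rw [Fin.sum_univ_three] at h0
    push_cast at h0
    linarith

/-! ## Schemes without errors -/

namespace CachingScheme

/-- The constraints on the encoding, the decoding and the privacy of a scheme, in a combinatorial
form and without errors. -/
structure IsPerfect {K N B : ℕ} (s : CachingScheme K N B) : Prop where
  encoding : ∀ k d w F F', s.content k (s.cacheMeta w k) F = s.content k (s.cacheMeta w k) F' →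
    s.payload k (s.txMeta w d k) F = s.payload k (s.txMeta w d k) F'
  decoding : ∀ k d w F F', (∀ j, s.payload j (s.txMeta w d j) F = s.payload j (s.txMeta w d j) F') →
    s.content k (s.cacheMeta w k) F = s.content k (s.cacheMeta w k) F' → F (d k) = F' (d k)
  privacy : ∀ (k : Fin K) (d d' : Demands K N), d k = d' k →
    s.seedLaw.map (fun w => (s.txMeta w d, s.cacheMeta w k)) =
      s.seedLaw.map (fun w => (s.txMeta w d', s.cacheMeta w k))

/-- The number of bits that describe a cache. -/
def cacheBits {K N B : ℕ} (s : CachingScheme K N B) : ℝ :=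
  Real.logb 2 (Fintype.card s.CacheMeta) + Real.logb 2 (Fintype.card s.Content)

/-- The number of bits that describe a signal. -/
def signalBits {K N B : ℕ} (s : CachingScheme K N B) : ℝ :=
  Real.logb 2 (Fintype.card s.TxMeta) + Real.logb 2 (Fintype.card s.Payload)

section Perfect

variable {K N B : ℕ} {s : CachingScheme K N B} {demandLaw : PMF (Demands K N)}

theorem nonempty_cacheMeta (s : CachingScheme K N B) (k : Fin K) : Nonempty s.CacheMeta :=
  let ⟨w, _⟩ := s.seedLaw.support_nonempty
  ⟨s.cacheMeta w k⟩

theorem nonempty_content (s : CachingScheme K N B) (k : Fin K) : Nonempty s.Content :=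
  let ⟨m⟩ := s.nonempty_cacheMeta k
  ⟨s.content k m 0⟩

theorem nonempty_txMeta (s : CachingScheme K N B) (k : Fin K) (d : Demands K N) :
    Nonempty s.TxMeta :=
  let ⟨w, _⟩ := s.seedLaw.support_nonempty
  ⟨s.txMeta w d k⟩

theorem nonempty_payload (s : CachingScheme K N B) (k : Fin K) (d : Demands K N) :
    Nonempty s.Payload :=
  let ⟨m⟩ := s.nonempty_txMeta k d
  ⟨s.payload k m 0⟩

theorem logb_card_prod (α β : Type) [Fintype α] [Fintype β] [Nonempty α] [Nonempty β] :
    Real.logb 2 (Fintype.card (α × β)) =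
      Real.logb 2 (Fintype.card α) + Real.logb 2 (Fintype.card β) := by
  rw [Fintype.card_prod, Nat.cast_mul, Real.logb_mul] <;>
    exact Nat.cast_ne_zero.2 Fintype.card_ne_zero

theorem logb_card_fun (α β : Type) [Fintype α] [DecidableEq α] [Fintype β] :
    Real.logb 2 (Fintype.card (α → β)) =
      Fintype.card α * Real.logb 2 (Fintype.card β) := by
  rw [Fintype.card_fun, Nat.cast_pow, Real.logb_pow]

theorem entropy_cache_le (k : Fin K) : entropy (s.law demandLaw) (s.cache k) ≤ s.cacheBits := by
  have := s.nonempty_cacheMeta k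
  have := s.nonempty_content k
  rw [cacheBits, ← logb_card_prod]
  exact entropy_le_logb_card _ _

theorem entropy_signal_le (k : Fin K) : entropy (s.law demandLaw) (s.signal k) ≤ s.signalBits := by
  obtain ⟨d, _⟩ := demandLaw.support_nonempty
  have := s.nonempty_txMeta k d
  have := s.nonempty_payload k d
  rw [signalBits, ← logb_card_prod]
  exact entropy_le_logb_card _ _

/-- Given the library, signals and cache are functions of the metadata. So the conditional
probability `G d` of an observation given the demands `d` depends on `d k` only, which is the
factorization that characterizes zero mutual information. -/
theorem condMutualInfo_eq_zero_of_map_eq {k : Fin K}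
    (h : ∀ d d' : Demands K N, d k = d' k →
      s.seedLaw.map (fun w => (s.txMeta w d, s.cacheMeta w k)) =
        s.seedLaw.map (fun w => (s.txMeta w d', s.cacheMeta w k))) :
    condMutualInfo (s.law demandLaw) s.demands
      (fun ω => (s.signals ω, s.cache k ω)) (s.demand k) = 0 := by
  rw [(condMutualInfo_nonneg_and_eq_zero_iff _ _ _ _).2]
  intro d y z
  set Y : s.Sample → (Fin K → s.TxMeta × s.Payload) × (s.CacheMeta × s.Content) :=
    fun ω => (s.signals ω, s.cache k ω) with hY
  by_cases hz : d k = z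
  swap
  · have e1 : ∀ {τ : Type} [Fintype τ] (X : s.Sample → τ) (x : τ), (∀ ω, X ω ≠ x) →
        pr (s.law demandLaw) X x = 0 := by
      classical
      intro τ _ X x hX
      rw [pr_eq_sum]
      exact Finset.sum_eq_zero fun ω _ => if_neg (hX ω).symm
    have e2 : pr (s.law demandLaw) (fun ω => (s.demands ω, Y ω, s.demand k ω)) (d, y, z) = 0 :=
      e1 _ _ fun ω h => hz <| by
        rw [← (Prod.mk.inj h).1]
        exact (Prod.mk.inj (Prod.mk.inj h).2).2
    have e3 : pr (s.law demandLaw) (fun ω => (s.demands ω, s.demand k ω)) (d, z) = 0 :=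
      e1 _ _ fun ω h => hz <| by
        rw [← (Prod.mk.inj h).1]
        exact (Prod.mk.inj h).2
    refine (mul_eq_zero_of_left e2 _).trans (mul_eq_zero_of_left e3 _).symm
  subst hz
  set G : Demands K N → ℝ := fun d => ∑ F, (uniformLibrary N B F).toReal *
    pr s.seedLaw (fun w => Y (F, d, w)) y with hG
  have hGd : ∀ d', d' k = d k → G d' = G d := by
    intro d' hd
    refine Finset.sum_congr rfl fun F _ => ?_
    congr 1
    let g : (Fin K → s.TxMeta) × s.CacheMeta →
        (Fin K → s.TxMeta × s.Payload) × (s.CacheMeta × s.Content) :=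
      fun t => (fun j => (t.1 j, s.payload j (t.1 j) F), (t.2, s.content k t.2 F))
    have := congrArg (PMF.map g) (h d' d hd)
    rw [PMF.map_comp, PMF.map_comp] at this
    exact congrArg (fun p => (p y).toReal) this
  have h3 : ∀ d', pr (s.law demandLaw) (fun ω => (s.demands ω, Y ω, s.demand k ω))
      (d', y, d' k) = (demandLaw d').toReal * G d' := by
    intro d'
    refine (pr_law_of_demand s demandLaw (fun ω => (s.demands ω, Y ω, s.demand k ω))
      fun _ h => (Prod.mk.inj h).1).trans ?_
    congr 1
    refine Finset.sum_congr rfl fun F _ => ?_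
    congr 1
    exact le_antisymm (pr_mono _ fun w h => (Prod.mk.inj (Prod.mk.inj h).2).1)
      (pr_mono _ fun w h => by
        simp only [demands, demand]
        rw [h])
  have h4 : pr (s.law demandLaw) (fun ω => (Y ω, s.demand k ω)) (y, d k) =
      G d * pr (s.law demandLaw) (s.demand k) (d k) := by
    rw [← sum_pr_pair_left (s.law demandLaw) s.demands (fun ω => (Y ω, s.demand k ω)),
      ← sum_pr_pair_left (s.law demandLaw) s.demands (s.demand k), Finset.mul_sum]
    refine Finset.sum_congr rfl fun d' _ => ?_
    by_cases hd : d' k = d k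
    · rw [← hd, h3, pr_demands_demand, hGd d' hd, mul_comm]
    · classical
      rw [pr_eq_sum, pr_eq_sum, Finset.sum_eq_zero, Finset.sum_eq_zero, mul_zero]
      · refine fun ω _ => if_neg fun h => hd ?_
        simp only [Prod.mk.injEq, demands, demand] at h
        rw [h.1, h.2]
      · refine fun ω _ => if_neg fun h => hd ?_
        simp only [Prod.mk.injEq, demands, demand] at h
        rw [h.1, h.2.2]
  refine (congrArg (· * _) (h3 d)).trans ?_
  refine Eq.trans ?_ (congrArg (_ * ·) h4.symm)
  rw [pr_demands_demand, mul_assoc]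

theorem IsPerfect.isValid (h : s.IsPerfect) {M R ε : ℝ} (hε : 0 ≤ ε)
    (hM : s.cacheBits ≤ B * (M + ε)) (hR : K * s.signalBits ≤ B * (R + ε)) :
    s.IsValid demandLaw M R ε where
  memory k := (entropy_cache_le k).trans hM
  encoding k := by
    refine condEntropy_eq_zero_of_determined _ ?_
    rintro ⟨F, d, w⟩ ⟨F', d', w'⟩ h'
    simp only [packetMeta, cache, signal, Prod.mk.injEq] at h' ⊢
    obtain ⟨h1, h2, h3⟩ := h'
    refine ⟨h1, ?_⟩
    rw [← h1]
    rw [← h2] at h3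
    exact h.encoding k d w F F' h3
  decoding k := by
    rw [condEntropy_eq_zero_of_determined]
    · positivity
    rintro ⟨F, d, w⟩ ⟨F', d', w'⟩ h'
    simp only [packetMeta, cache, signals, signal, demand, demandedFile, Prod.mk.injEq,
      funext_iff] at h' ⊢
    obtain ⟨h1, ⟨h2, h3⟩, h4⟩ := h'
    rw [← h4]
    rw [← h2] at h3
    intro b
    refine congrFun (h.decoding k d w F F' (fun j => ?_) h3) b
    have := (h1 j).2
    rwa [← (h1 j).1] at this
  privacy k := condMutualInfo_eq_zero_of_map_eq (h.privacy k)
  load := by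
    refine le_trans (Finset.sum_le_sum fun k _ => entropy_signal_le k) ?_
    simpa using hR

end Perfect

end CachingScheme

/-! ### Correctness and cost of the building blocks of Scheme B -/

namespace SchemeB

open CachingScheme

section Share

variable {K N B₁ B₂ : ℕ} {s₁ : CachingScheme K N B₁} {s₂ : CachingScheme K N B₂}

theorem isPerfect_share (h₁ : s₁.IsPerfect) (h₂ : s₂.IsPerfect) : (share s₁ s₂).IsPerfect where
  encoding k d w F F' h := by
    simp only [SchemeB.share, Prod.mk.injEq] at h ⊢
    exact ⟨h₁.encoding k d w.1 _ _ h.1, h₂.encoding k d w.2 _ _ h.2⟩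
  decoding k d w F F' hj h := by
    simp only [SchemeB.share, Prod.mk.injEq] at h hj
    have e₁ := h₁.decoding k d w.1 _ _ (fun j => (hj j).1) h.1
    have e₂ := h₂.decoding k d w.2 _ _ (fun j => (hj j).2) h.2
    ext b
    refine Fin.addCases (fun b => ?_) (fun b => ?_) b
    · exact congrFun e₁ b
    · exact congrFun e₂ b
  privacy k d d' hd := by
    have key : ∀ d : Demands K N, (SchemeB.share s₁ s₂).seedLaw.map (fun w =>
        ((SchemeB.share s₁ s₂).txMeta w d, (SchemeB.share s₁ s₂).cacheMeta w k)) =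
        (s₁.seedLaw.map (fun w => (s₁.txMeta w d, s₁.cacheMeta w k))).bind fun x =>
          (s₂.seedLaw.map (fun w => (s₂.txMeta w d, s₂.cacheMeta w k))).map fun y =>
            ((fun j => (x.1 j, y.1 j)), (x.2, y.2)) := by
      intro d
      simp only [SchemeB.share, PMF.map_bind, PMF.bind_map, PMF.map_comp]
      rfl
    rw [key, key, h₁.privacy k d d' hd, h₂.privacy k d d' hd]

theorem cacheBits_share (k : Fin K) :
    (share s₁ s₂).cacheBits = s₁.cacheBits + s₂.cacheBits := by
  have := s₁.nonempty_cacheMeta k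
  have := s₂.nonempty_cacheMeta k
  have := s₁.nonempty_content k
  have := s₂.nonempty_content k
  have h1 := logb_card_prod s₁.CacheMeta s₂.CacheMeta
  have h2 := logb_card_prod s₁.Content s₂.Content
  calc (share s₁ s₂).cacheBits = Real.logb 2 (Fintype.card (s₁.CacheMeta × s₂.CacheMeta)) +
        Real.logb 2 (Fintype.card (s₁.Content × s₂.Content)) := rfl
    _ = _ := by
      rw [h1, h2, cacheBits, cacheBits]
      ring

theorem signalBits_share (k : Fin K) (d : Demands K N) :
    (share s₁ s₂).signalBits = s₁.signalBits + s₂.signalBits := by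
  have := s₁.nonempty_txMeta k d
  have := s₂.nonempty_txMeta k d
  have := s₁.nonempty_payload k d
  have := s₂.nonempty_payload k d
  have h1 := logb_card_prod s₁.TxMeta s₂.TxMeta
  have h2 := logb_card_prod s₁.Payload s₂.Payload
  calc (share s₁ s₂).signalBits = Real.logb 2 (Fintype.card (s₁.TxMeta × s₂.TxMeta)) +
        Real.logb 2 (Fintype.card (s₁.Payload × s₂.Payload)) := rfl
    _ = _ := by
      rw [h1, h2, signalBits, signalBits]
      ring

end Share

section CacheAll

variable (N B : ℕ)

theorem isPerfect_cacheAll : (cacheAll N B).IsPerfect where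
  encoding _ _ _ _ _ _ := rfl
  decoding _ d _ _ _ _ h := congrFun h (d _)
  privacy _ _ _ _ := rfl

theorem cacheBits_cacheAll : (cacheAll N B).cacheBits = N * B := by
  calc (cacheAll N B).cacheBits = Real.logb 2 (Fintype.card Unit) +
        Real.logb 2 (Fintype.card (Library N B)) := rfl
    _ = N * B := by
      rw [logb_card_fun, logb_card_fun, ZMod.card]
      simp

theorem signalBits_cacheAll : (cacheAll N B).signalBits = 0 := by
  calc (cacheAll N B).signalBits = Real.logb 2 (Fintype.card Unit) +
        Real.logb 2 (Fintype.card Unit) := rfl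
    _ = 0 := by simp

end CacheAll

section Corner

variable {N t ℓ : ℕ}
  {pick : Fin N → (S : Group N t) → {i // i ∈ S.1} → Fin (subfileCount N t)}

theorem exists_position {U : ℕ} (x : Fin (2 * (U * ℓ))) : ∃ k j b, x = position k j b := by
  obtain ⟨⟨k, y⟩, rfl⟩ := finProdFinEquiv.surjective x
  obtain ⟨⟨j, b⟩, rfl⟩ := finProdFinEquiv.surjective y
  exact ⟨k, j, b, rfl⟩

theorem map_uniformOfFintype_equiv {α : Type} [Fintype α] [Nonempty α] (e : α ≃ α) :
    (PMF.uniformOfFintype α).map e = PMF.uniformOfFintype α := by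
  classical
  ext a
  rw [PMF.map_apply, tsum_eq_single (e.symm a)]
  · simp
  · intro b hb
    rw [if_neg]
    rintro rfl
    simp at hb

theorem exists_perm_comp_eq {α β : Type} [Fintype β] [DecidableEq β] {f g : α → β}
    (hf : Function.Injective f) (hg : Function.Injective g) :
    ∃ σ : Equiv.Perm β, ∀ a, σ (f a) = g a := by
  classical
  let e : {b // b ∈ Set.range f} ≃ {b // b ∈ Set.range g} :=
    (Equiv.ofInjective f hf).symm.trans (Equiv.ofInjective g hg)
  refine ⟨e.extendSubtype, fun a => ?_⟩
  rw [e.extendSubtype_apply_of_mem _ ⟨a, rfl⟩]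
  simp only [e, Equiv.trans_apply]
  have : (Equiv.ofInjective f hf).symm ⟨f a, a, rfl⟩ = a := Equiv.ofInjective_symm_apply hf a
  rw [this, Equiv.ofInjective_apply]

/-- The groups with a given file. -/
abbrev GroupOf (t : ℕ) (i : Fin N) : Type := {S : Group N t // i ∈ S.1}

/-- User `k` knows permuted positions in the other user's half, and the picks from that half depend
on `d k` alone. Only the picks from its own half depend on the hidden demand, and the permutations
of that half are unknown to it. Composing them with a fixed `τ`, which carries the picks for one
demand to those for the other, preserves the uniform law. -/
theorem privacy_corner (hpick : IsPickRule N t pick) (k : Fin 2) (d d' : Demands 2 N)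
    (hd : d k = d' k) :
    (corner N t ℓ pick).seedLaw.map
        (fun w => ((corner N t ℓ pick).txMeta w d, (corner N t ℓ pick).cacheMeta w k)) =
      (corner N t ℓ pick).seedLaw.map
        (fun w => ((corner N t ℓ pick).txMeta w d', (corner N t ℓ pick).cacheMeta w k)) := by
  have hinj : ∀ e i : Fin N,
      Function.Injective fun S : GroupOf t i => pick e S.1 ⟨i, S.2⟩ := fun e i S S' h =>
    Subtype.ext (hpick.injective e i S.1 S'.1 S.2 S'.2 h)
  choose τ hτ using fun i => exists_perm_comp_eq (hinj (d k.rev) i) (hinj (d' k.rev) i)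
  let g : Fin 2 → Fin N → Equiv.Perm (Fin (subfileCount N t)) := fun j =>
    if j = k then τ else 1
  let T : Demands 2 N → (Fin 2 → Fin N → Equiv.Perm (Fin (subfileCount N t))) →
      (Fin 2 → (corner N t ℓ pick).TxMeta) × (corner N t ℓ pick).CacheMeta :=
    fun d w => ((corner N t ℓ pick).txMeta w d, (corner N t ℓ pick).cacheMeta w k)
  have h1 : T d' = T d ∘ Equiv.mulRight g := by
    funext w
    refine Prod.ext ?_ ?_
    · funext j S i
      change w j i.1 (pick (d' j.rev) S i) = (w j i.1 * g j i.1) (pick (d j.rev) S i)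
      rw [Equiv.Perm.mul_apply]
      by_cases hj : j = k
      · subst hj
        have := hτ i.1 ⟨S, i.2⟩
        simp only [g, if_true]
        rw [← this]
      · have hj' : j.rev = k := by
          revert hj
          fin_cases j <;> fin_cases k <;> simp
        simp only [g, if_neg hj, hj', hd, Pi.one_apply, Equiv.Perm.one_apply]
    · funext i j
      change w k.rev i (Fin.castAdd _ j) = (w k.rev i * g k.rev i) (Fin.castAdd _ j)
      have hk : k.rev ≠ k := by fin_cases k <;> simp
      simp only [g, if_neg hk, Pi.one_apply, mul_one]
  have h2 : (PMF.uniformOfFintype _).map (T d) = (PMF.uniformOfFintype _).map (T d') := by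
    rw [h1, ← PMF.map_comp, map_uniformOfFintype_equiv]
  exact h2

/-- Only the other user's half is in question, and its subfiles of rank below `sharedCount` are
cached. Any other subfile of the demanded file is picked for some group, and all the other terms of
that message are cached by the pick rule, so they cancel. -/
theorem decoding_corner (hpick : IsPickRule N t pick)
    (hsurj : ∀ (d : Fin N) (r : Fin (subfileCount N t)), sharedCount N t ≤ r →
      ∃ (S : Group N t) (h : d ∈ S.1), pick d S ⟨d, h⟩ = r)
    (k : Fin 2) (d : Demands 2 N) (w : (corner N t ℓ pick).Seed) (F F' : Library N _)
    (hp : ∀ j, (corner N t ℓ pick).payload j ((corner N t ℓ pick).txMeta w d j) F =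
      (corner N t ℓ pick).payload j ((corner N t ℓ pick).txMeta w d j) F')
    (hc : (corner N t ℓ pick).content k ((corner N t ℓ pick).cacheMeta w k) F =
      (corner N t ℓ pick).content k ((corner N t ℓ pick).cacheMeta w k) F') :
    F (d k) = F' (d k) := by
  have hown : ∀ i j b, F i (position k j b) = F' i (position k j b) := fun i j b =>
    congrFun (congrFun (congrFun (Prod.mk.inj hc).1 i) j) b
  have hshared : ∀ (i : Fin N) (r : Fin (subfileCount N t)) (b : Fin ℓ),
      (r : ℕ) < sharedCount N t →
      F i (position k.rev (w k.rev i r) b) = F' i (position k.rev (w k.rev i r) b) :=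
    fun i r b hr => congrFun (congrFun (congrFun (Prod.mk.inj hc).2 i) ⟨r, hr⟩) b
  ext x
  obtain ⟨k', j, b, rfl⟩ := exists_position x
  by_cases hk : k' = k
  · rw [hk]
    exact hown _ _ _
  have hk' : k' = k.rev := by
    revert hk
    fin_cases k <;> fin_cases k' <;> simp
  subst hk'
  obtain ⟨r, rfl⟩ := (w k.rev (d k)).surjective j
  by_cases hr : (r : ℕ) < sharedCount N t
  · exact hshared _ r b hr
  obtain ⟨S, hS, rfl⟩ := hsurj (d k) r (not_lt.1 hr)
  have hpay : ∑ i : {i // i ∈ S.1},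
      F i.1 (position k.rev (w k.rev i.1 (pick (d k.rev.rev) S i)) b) =
        ∑ i : {i // i ∈ S.1},
          F' i.1 (position k.rev (w k.rev i.1 (pick (d k.rev.rev) S i)) b) :=
    congrFun (congrFun (hp k.rev) S) b
  rw [Fin.rev_rev, ← Finset.add_sum_erase _ _ (Finset.mem_univ ⟨d k, hS⟩),
    ← Finset.add_sum_erase _ _ (Finset.mem_univ ⟨d k, hS⟩)] at hpay
  rw [Finset.sum_congr rfl fun i hi => hshared i.1 (pick (d k) S i) b
    ((hpick.shared_iff (d k) S i).2 ⟨hS, fun h => Finset.ne_of_mem_erase hi (Subtype.ext h)⟩)]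
    at hpay
  exact add_right_cancel hpay

theorem isPerfect_corner (hpick : IsPickRule N t pick)
    (hsurj : ∀ (d : Fin N) (r : Fin (subfileCount N t)), sharedCount N t ≤ r →
      ∃ (S : Group N t) (h : d ∈ S.1), pick d S ⟨d, h⟩ = r) :
    (corner N t ℓ pick).IsPerfect where
  encoding k d w F F' hc := by
    have hown : ∀ i j b, F i (position k j b) = F' i (position k j b) := fun i j b =>
      congrFun (congrFun (congrFun (Prod.mk.inj hc).1 i) j) b
    funext S b
    exact Finset.sum_congr rfl fun i _ => hown _ _ _
  decoding := decoding_corner hpick hsurj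
  privacy := privacy_corner hpick

/-- If there are `C(N-1, t)` sets of `t + 1` files that contain a given file, then each subfile that
is not shared is sent. -/
theorem exists_pick_eq (hpick : IsPickRule N t pick) (d : Fin N)
    (hcard : Fintype.card (GroupOf t d) = (N - 1).choose t)
    (r : Fin (subfileCount N t)) (hr : sharedCount N t ≤ r) :
    ∃ (S : Group N t) (h : d ∈ S.1), pick d S ⟨d, h⟩ = r := by
  have hlt : ∀ r : Fin (subfileCount N t), (r : ℕ) < sharedCount N t + (N - 1).choose t :=
    fun r => r.2
  have hge : ∀ S : GroupOf t d, sharedCount N t ≤ (pick d S.1 ⟨d, S.2⟩ : ℕ) := fun S =>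
    not_lt.1 ((hpick.shared_iff d S.1 ⟨d, S.2⟩).not.2 (by simp))
  let f : GroupOf t d → Fin ((N - 1).choose t) := fun S =>
    ⟨pick d S.1 ⟨d, S.2⟩ - sharedCount N t, by
      have := hlt (pick d S.1 ⟨d, S.2⟩)
      have := hge S
      omega⟩
  have hval : ∀ S, (f S : ℕ) + sharedCount N t = pick d S.1 ⟨d, S.2⟩ := fun S =>
    Nat.sub_add_cancel (hge S)
  have hf : Function.Injective f := by
    intro S S' h
    refine Subtype.ext (hpick.injective d d S.1 S'.1 S.2 S'.2 (Fin.ext ?_))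
    rw [← hval, ← hval, h]
  have hb : Function.Bijective f :=
    (Fintype.bijective_iff_injective_and_card f).2 ⟨hf, by rw [hcard, Fintype.card_fin]⟩
  obtain ⟨S, hS⟩ := hb.2 ⟨r - sharedCount N t, by
    have := hlt r
    omega⟩
  refine ⟨S.1, S.2, Fin.ext ?_⟩
  rw [← hval, hS]
  simp only
  omega

/-- A pick rule exists as soon as there are no more groups of each kind than subfiles. -/
theorem exists_isPickRule
    (hshared : ∀ d i : Fin N, Fintype.card {S : GroupOf t i // d ∈ S.1.1 ∧ i ≠ d} ≤
      sharedCount N t)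
    (hrest : ∀ d i : Fin N, Fintype.card {S : GroupOf t i // ¬(d ∈ S.1.1 ∧ i ≠ d)} ≤
      (N - 1).choose t) :
    ∃ pick : Fin N → (S : Group N t) → {i // i ∈ S.1} → Fin (subfileCount N t),
      IsPickRule N t pick := by
  have h₁ : ∀ d i, Nonempty ({S : GroupOf t i // d ∈ S.1.1 ∧ i ≠ d} ↪ Fin (sharedCount N t)) :=
    fun d i => Function.Embedding.nonempty_of_card_le (by simpa using hshared d i)
  have h₂ : ∀ d i, Nonempty ({S : GroupOf t i // ¬(d ∈ S.1.1 ∧ i ≠ d)} ↪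
      Fin ((N - 1).choose t)) :=
    fun d i => Function.Embedding.nonempty_of_card_le (by simpa using hrest d i)
  let f := fun d i => (h₁ d i).some
  let g := fun d i => (h₂ d i).some
  let pick : Fin N → (S : Group N t) → {i // i ∈ S.1} → Fin (subfileCount N t) := fun d S i =>
    if h : d ∈ S.1 ∧ i.1 ≠ d then Fin.castAdd _ (f d i.1 ⟨⟨S, i.2⟩, h⟩)
    else Fin.natAdd _ (g d i.1 ⟨⟨S, i.2⟩, h⟩)
  have hiff : ∀ (d : Fin N) (S : Group N t) (i : {i // i ∈ S.1}),
      (pick d S i : ℕ) < sharedCount N t ↔ d ∈ S.1 ∧ i.1 ≠ d := by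
    intro d S i
    simp only [pick]
    split_ifs with h
    · simp [h]
    · simp [h]
  refine ⟨pick, fun d i S S' hS hS' heq => ?_, hiff⟩
  -- Equal ranks lie on the same side of `sharedCount`, so the two groups are of the same kind and
  -- were numbered by the same embedding.
  have e : (d ∈ S.1 ∧ i ≠ d) ↔ (d ∈ S'.1 ∧ i ≠ d) := by
    rw [← hiff d S ⟨i, hS⟩, ← hiff d S' ⟨i, hS'⟩, heq]
  by_cases h : d ∈ S.1 ∧ i ≠ d
  · have heq' := (dif_pos h).symm.trans (heq.trans (dif_pos (e.1 h)))
    exact congrArg (fun x => x.1.1) ((f d i).injective (Fin.castAdd_injective _ _ heq'))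
  · have heq' := (dif_neg h).symm.trans (heq.trans (dif_neg (mt e.2 h)))
    exact congrArg (fun x => x.1.1) ((g d i).injective (Fin.natAdd_injective _ _ heq'))

/-- The first term, due to the metadata, does not involve `ℓ`. It is therefore negligible for large
files. -/
theorem cacheBits_corner : (corner N t ℓ pick).cacheBits =
    Real.logb 2 (Fintype.card (Fin N → Fin (sharedCount N t) → Fin (subfileCount N t))) +
      (N * (subfileCount N t + sharedCount N t) : ℝ) * ℓ := by
  have h1 := logb_card_prod (Fin N → Fin (subfileCount N t) → Fin ℓ → ZMod 2)
    (Fin N → Fin (sharedCount N t) → Fin ℓ → ZMod 2)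
  calc (corner N t ℓ pick).cacheBits =
      Real.logb 2 (Fintype.card (Fin N → Fin (sharedCount N t) → Fin (subfileCount N t))) +
        Real.logb 2 (Fintype.card ((Fin N → Fin (subfileCount N t) → Fin ℓ → ZMod 2) ×
          (Fin N → Fin (sharedCount N t) → Fin ℓ → ZMod 2))) := rfl
    _ = _ := by
      rw [h1]
      simp only [logb_card_fun, Fintype.card_fin, ZMod.card]
      push_cast
      rw [Real.logb_self_eq_one one_lt_two]
      ring

theorem signalBits_corner : (corner N t ℓ pick).signalBits =
    Real.logb 2 (Fintype.card ((S : Group N t) → {i // i ∈ S.1} → Fin (subfileCount N t))) +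
      (N.choose (t + 1) : ℝ) * ℓ := by
  calc (corner N t ℓ pick).signalBits =
      Real.logb 2 (Fintype.card ((S : Group N t) → {i // i ∈ S.1} → Fin (subfileCount N t))) +
        Real.logb 2 (Fintype.card (Group N t → Fin ℓ → ZMod 2)) := rfl
    _ = _ := by
      have : Fintype.card (Group N t) = N.choose (t + 1) := by
        rw [Fintype.card_finset_len, Fintype.card_fin]
      simp only [logb_card_fun, Fintype.card_fin, ZMod.card, this]
      push_cast
      rw [Real.logb_self_eq_one one_lt_two]
      ring

end Corner
end SchemeB

namespace SchemeB

open CachingScheme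

/-! ## Scheme B has uncoded placement -/

theorem IsSchemeB.isUncoded {N B : ℕ} {s : CachingScheme 2 N B} (h : IsSchemeB N B s) :
    s.IsUncoded := by
  induction h with
  | corner t ℓ ht pick hpick =>
    intro k m
    refine ⟨{x | ∃ i j b, x = (i, position k j b)} ∪
      {x | ∃ i j b, x = (i, position k.rev (m i j) b)}, fun F F' => ⟨fun h => ?_, fun h => ?_⟩⟩
    · rintro _ (⟨i, j, b, rfl⟩ | ⟨i, j, b, rfl⟩)
      · exact congrFun (congrFun (congrFun (Prod.mk.inj h).1 i) j) b
      · exact congrFun (congrFun (congrFun (Prod.mk.inj h).2 i) j) b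
    · refine Prod.ext ?_ ?_
      · funext i j b
        exact h (i, position k j b) (Or.inl ⟨i, j, b, rfl⟩)
      · funext i j b
        exact h (i, position k.rev (m i j) b) (Or.inr ⟨i, j, b, rfl⟩)
  | cacheAll B =>
    intro k m
    refine ⟨Set.univ, fun F F' => ⟨fun h x _ => ?_, fun h => ?_⟩⟩
    · exact congrFun (congrFun h x.1) x.2
    · funext i b
      exact h (i, b) trivial
  | @share B₁ B₂ s₁ s₂ h₁ h₂ ih₁ ih₂ =>
    intro k m
    obtain ⟨S₁, hS₁⟩ := ih₁ k m.1
    obtain ⟨S₂, hS₂⟩ := ih₂ k m.2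
    refine ⟨(fun x => (x.1, Fin.castAdd B₂ x.2)) '' S₁ ∪ (fun x => (x.1, Fin.natAdd B₁ x.2)) '' S₂,
      fun F F' => ?_⟩
    simp only [SchemeB.share, Prod.mk.injEq, hS₁, hS₂, Set.mem_union, or_imp, forall_and,
      Set.forall_mem_image]

/-! ## The memory-load pairs that Scheme B achieves -/

/-- For every file size, Scheme B achieves the given pair of cache size and load up to a constant
number of bits, and without errors. -/
def IsAchieved (N : ℕ) (p : ℝ × ℝ) : Prop :=
  ∃ c : ℝ, ∀ B : ℕ, ∃ s : CachingScheme 2 N B, IsSchemeB N B s ∧ s.IsPerfect ∧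
    s.cacheBits ≤ B * p.1 + c ∧ 2 * s.signalBits ≤ B * p.2 + c

theorem IsAchieved.achievable {N : ℕ} {p : ℝ × ℝ} (h : IsAchieved N p)
    (demandLaw : PMF (Demands 2 N)) : Achievable (IsSchemeB N) demandLaw p.1 p.2 := by
  obtain ⟨c, hc⟩ := h
  refine ⟨fun B => max c 0 / B, fun B => by positivity, ?_, ?_⟩
  · exact tendsto_const_div_atTop_nhds_zero_nat (max c 0)
  · filter_upwards [eventually_gt_atTop 0] with B hB
    obtain ⟨s, hs, hperf, h₁, h₂⟩ := hc B
    have hB' : (0 : ℝ) < B := by exact_mod_cast hB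
    have h3 : ∀ x : ℝ, B * (x + max c 0 / B) = B * x + max c 0 := fun x => by field_simp
    refine ⟨s, hs, hperf.isValid (by positivity) ?_ ?_⟩
    · rw [h3]
      exact h₁.trans (by gcongr; exact le_max_left c 0)
    · rw [h3]
      exact h₂.trans (by gcongr; exact le_max_left c 0)

theorem convex_isAchieved (N : ℕ) [NeZero N] : Convex ℝ {p | IsAchieved N p} := by
  rintro p ⟨c, hp⟩ q ⟨c', hq⟩ a b ha hb hab
  refine ⟨c + c' + (|p.1| + |q.1| + |p.2| + |q.2|), fun B => ?_⟩
  -- Each file is cut at the integer part of `a * B`. This misplaces at most one bit per file, which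
  -- costs only a constant.
  obtain ⟨B₁, B₂, hB, h₁⟩ : ∃ B₁ B₂ : ℕ, B₁ + B₂ = B ∧ |(B₁ : ℝ) - a * B| ≤ 1 := by
    have h0 : 0 ≤ a * (B : ℝ) := by positivity
    have hle : ⌊a * (B : ℝ)⌋₊ ≤ B := by
      refine Nat.floor_le_of_le ?_
      have : (0 : ℝ) ≤ b * B := by positivity
      have : a * B + b * B = B := by rw [← add_mul, hab, one_mul]
      linarith
    refine ⟨⌊a * (B : ℝ)⌋₊, B - ⌊a * (B : ℝ)⌋₊, by omega, ?_⟩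
    rw [abs_le]
    constructor
    · linarith [Nat.lt_floor_add_one (a * (B : ℝ))]
    · linarith [Nat.floor_le h0]
  subst hB
  obtain ⟨s₁, hs₁, hperf₁, m₁, l₁⟩ := hp B₁
  obtain ⟨s₂, hs₂, hperf₂, m₂, l₂⟩ := hq B₂
  have hround : ∀ x y : ℝ, B₁ * x + B₂ * y ≤
      ((B₁ + B₂ : ℕ) : ℝ) * (a * x + b * y) + (|x| + |y|) := by
    intro x y
    have e : B₁ * x + B₂ * y - ((B₁ + B₂ : ℕ) : ℝ) * (a * x + b * y) =
        ((B₁ : ℝ) - a * (B₁ + B₂ : ℕ)) * (x - y) := by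
      rw [eq_sub_of_add_eq' hab]
      push_cast
      ring
    have : ((B₁ : ℝ) - a * (B₁ + B₂ : ℕ)) * (x - y) ≤ 1 * (|x| + |y|) := by
      refine (le_abs_self _).trans ?_
      rw [abs_mul]
      exact mul_le_mul h₁ (abs_sub x y) (abs_nonneg _) zero_le_one
    linarith
  refine ⟨share s₁ s₂, .share s₁ s₂ hs₁ hs₂, isPerfect_share hperf₁ hperf₂, ?_, ?_⟩
  · rw [cacheBits_share 0]
    have := hround p.1 q.1
    have := abs_nonneg p.2
    have := abs_nonneg q.2
    simp only [Prod.fst_add, Prod.smul_fst, smul_eq_mul]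
    linarith
  · rw [signalBits_share 0 0]
    have := hround p.2 q.2
    have := abs_nonneg p.1
    have := abs_nonneg q.1
    simp only [Prod.snd_add, Prod.smul_snd, smul_eq_mul]
    linarith

theorem isAchieved_cacheAll (N : ℕ) : IsAchieved N (N, 0) := by
  refine ⟨0, fun B => ⟨cacheAll N B, .cacheAll B, isPerfect_cacheAll N B, ?_, ?_⟩⟩
  · rw [cacheBits_cacheAll, add_zero, mul_comm]
  · rw [signalBits_cacheAll]
    simp

theorem isAchieved_corner {N t : ℕ} [NeZero N] (ht : t < N)
    (hshared : ∀ d i : Fin N, Fintype.card {S : GroupOf t i // d ∈ S.1.1 ∧ i ≠ d} ≤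
      sharedCount N t)
    (hrest : ∀ d i : Fin N, Fintype.card {S : GroupOf t i // ¬(d ∈ S.1.1 ∧ i ≠ d)} ≤
      (N - 1).choose t)
    (hcard : ∀ d : Fin N, Fintype.card (GroupOf t d) = (N - 1).choose t) {p : ℝ × ℝ}
    (hp₁ : p.1 * (2 * subfileCount N t) = N * (subfileCount N t + sharedCount N t))
    (hp₂ : p.2 * subfileCount N t = N.choose (t + 1)) : IsAchieved N p := by
  obtain ⟨pick, hpick⟩ := exists_isPickRule hshared hrest
  have hpos : 0 < subfileCount N t :=
    Nat.add_pos_right _ (Nat.choose_pos (Nat.le_sub_one_of_lt ht))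
  have hpos' : (0 : ℝ) < subfileCount N t := by exact_mod_cast hpos
  have h₁ : 0 ≤ p.1 := nonneg_of_mul_nonneg_left (b := 2 * (subfileCount N t : ℝ))
    (by rw [hp₁]; positivity) (by positivity)
  have h₂ : 0 ≤ p.2 := nonneg_of_mul_nonneg_left (by rw [hp₂]; positivity) hpos'
  set c₁ := Real.logb 2
    (Fintype.card (Fin N → Fin (sharedCount N t) → Fin (subfileCount N t))) with hc₁
  set c₂ := Real.logb 2
    (Fintype.card ((S : Group N t) → {i // i ∈ S.1} → Fin (subfileCount N t))) with hc₂
  refine ⟨|c₁| + 2 * |c₂| + N * (2 * subfileCount N t), fun B => ?_⟩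
  -- The `r` bits of each file that do not fill whole subfiles are cached by both users. They add a
  -- bounded amount of memory and no load.
  obtain ⟨ℓ, r, hr, hB⟩ : ∃ ℓ r : ℕ, r < 2 * subfileCount N t ∧
      2 * (subfileCount N t * ℓ) + r = B :=
    ⟨B / (2 * subfileCount N t), B % (2 * subfileCount N t), Nat.mod_lt _ (by omega), by
      rw [← mul_assoc, Nat.div_add_mod]⟩
  subst hB
  have hr' : (r : ℝ) ≤ 2 * subfileCount N t := by exact_mod_cast hr.le
  have hr0 : (0 : ℝ) ≤ r := by positivity
  refine ⟨share (corner N t ℓ pick) (cacheAll N r),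
    .share _ _ (.corner t ℓ ht pick hpick) (.cacheAll r),
    isPerfect_share
      (isPerfect_corner hpick fun d r hr => exists_pick_eq hpick d (hcard d) r hr)
      (isPerfect_cacheAll N r), ?_, ?_⟩
  · rw [cacheBits_share 0, cacheBits_cacheAll, cacheBits_corner, ← hp₁, ← hc₁]
    have : (N : ℝ) * r ≤ N * (2 * subfileCount N t) := by gcongr
    have : 0 ≤ r * p.1 := by positivity
    have := le_abs_self c₁
    have := abs_nonneg c₂
    push_cast
    linarith
  · rw [signalBits_share 0 0, signalBits_cacheAll, signalBits_corner, ← hp₂, ← hc₂]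
    have : (0 : ℝ) ≤ N * (2 * subfileCount N t) := by positivity
    have : 0 ≤ r * p.2 := by positivity
    have := le_abs_self c₂
    have := abs_nonneg c₁
    push_cast
    linarith

theorem isAchieved_of_mem_cornerPoints {N : ℕ} (hN : N = 2 ∨ N = 3) {p : ℝ × ℝ}
    (hp : p ∈ cornerPoints N) : IsAchieved N p := by
  have : NeZero N := ⟨by omega⟩
  rcases hp with rfl | ⟨t, ht, rfl⟩
  · exact isAchieved_cacheAll N
  · rcases hN with rfl | rfl <;> interval_cases t
    all_goals
      refine isAchieved_corner ht (by decide) (by decide) (by decide) ?_ ?_ <;>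
        norm_num [subfileCount, sharedCount, Nat.choose]

theorem isAchieved_of_mem_convexHull {N : ℕ} (hN : N = 2 ∨ N = 3) {p : ℝ × ℝ}
    (hp : p ∈ convexHull ℝ (cornerPoints N)) : IsAchieved N p := by
  have : NeZero N := ⟨by omega⟩
  exact convexHull_min (fun p hp => isAchieved_of_mem_cornerPoints hN hp) (convex_isAchieved N) hp

/-! ## The lower convex envelope of the corner points -/

theorem cornerPoint_mem {N t : ℕ} (ht : t < N) {x y : ℝ}
    (hx : (N : ℝ) / 2 + (N : ℝ) * t / (2 * ((N : ℝ) + t - 1)) = x)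
    (hy : (N : ℝ) * ((N : ℝ) - 1) / (((t : ℝ) + 1) * ((N : ℝ) + t - 1)) = y) :
    (x, y) ∈ convexHull ℝ (cornerPoints N) :=
  subset_convexHull ℝ _ (Or.inr ⟨t, ht, by rw [hx, hy]⟩)

theorem lastPoint_mem {N : ℕ} {x : ℝ} (hx : (N : ℝ) = x) :
    (x, (0 : ℝ)) ∈ convexHull ℝ (cornerPoints N) :=
  subset_convexHull ℝ _ (Or.inl (by rw [hx]; rfl))

/-- Linear interpolation between two points of a convex set. -/
theorem mem_of_segment {s : Set (ℝ × ℝ)} (hs : Convex ℝ s) {x₁ y₁ x₂ y₂ x y : ℝ}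
    (h₁ : (x₁, y₁) ∈ s) (h₂ : (x₂, y₂) ∈ s) (hlt : x₁ < x₂) (hx₁ : x₁ ≤ x) (hx₂ : x ≤ x₂)
    (hy : y * (x₂ - x₁) = y₁ * (x₂ - x) + y₂ * (x - x₁)) : (x, y) ∈ s := by
  have hd : 0 < x₂ - x₁ := sub_pos.2 hlt
  have h := hs h₁ h₂ (a := (x₂ - x) / (x₂ - x₁)) (b := (x - x₁) / (x₂ - x₁))
    (div_nonneg (sub_nonneg.2 hx₂) hd.le) (div_nonneg (sub_nonneg.2 hx₁) hd.le)
    (by field_simp; ring)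
  convert h using 1
  ext
  · simp only [Prod.fst_add, Prod.smul_fst, smul_eq_mul]
    field_simp
    ring
  · simp only [Prod.snd_add, Prod.smul_snd, smul_eq_mul]
    field_simp
    linarith

/-- Consecutive corner points span segments of exactly the lines bounding the load in
`converse_two_files`. -/
theorem exists_mem_convexHull_two {M : ℝ} (hM : M ∈ Set.Icc (1 : ℝ) 2) :
    ∃ r, (M, r) ∈ convexHull ℝ (cornerPoints 2) ∧ (r = 5 - 3 * M ∨ r = 2 - M) := by
  have h0 : ((1 : ℝ), (2 : ℝ)) ∈ convexHull ℝ (cornerPoints 2) :=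
    cornerPoint_mem (t := 0) (by norm_num) (by norm_num) (by norm_num)
  have h1 : ((3 / 2 : ℝ), (1 / 2 : ℝ)) ∈ convexHull ℝ (cornerPoints 2) :=
    cornerPoint_mem (t := 1) (by norm_num) (by norm_num) (by norm_num)
  have h2 : ((2 : ℝ), (0 : ℝ)) ∈ convexHull ℝ (cornerPoints 2) := lastPoint_mem (by norm_num)
  rcases le_total M (3 / 2) with h | h
  · exact ⟨_, mem_of_segment (convex_convexHull ℝ _) h0 h1 (by norm_num) hM.1 h (by ring),
      Or.inl rfl⟩
  · exact ⟨_, mem_of_segment (convex_convexHull ℝ _) h1 h2 (by norm_num) h hM.2 (by ring),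
      Or.inr rfl⟩

theorem exists_mem_convexHull_three {M : ℝ} (hM : M ∈ Set.Icc (3 / 2 : ℝ) 3) :
    ∃ r, (M, r) ∈ convexHull ℝ (cornerPoints 3) ∧
      (r = 9 - 4 * M ∨ r = 5 - 2 * M ∨ r = 2 - 2 / 3 * M) := by
  have h0 : ((3 / 2 : ℝ), (3 : ℝ)) ∈ convexHull ℝ (cornerPoints 3) :=
    cornerPoint_mem (t := 0) (by norm_num) (by norm_num) (by norm_num)
  have h1 : ((2 : ℝ), (1 : ℝ)) ∈ convexHull ℝ (cornerPoints 3) :=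
    cornerPoint_mem (t := 1) (by norm_num) (by norm_num) (by norm_num)
  have h2 : ((9 / 4 : ℝ), (1 / 2 : ℝ)) ∈ convexHull ℝ (cornerPoints 3) :=
    cornerPoint_mem (t := 2) (by norm_num) (by norm_num) (by norm_num)
  have h3 : ((3 : ℝ), (0 : ℝ)) ∈ convexHull ℝ (cornerPoints 3) := lastPoint_mem (by norm_num)
  rcases le_total M 2 with h | h
  · exact ⟨_, mem_of_segment (convex_convexHull ℝ _) h0 h1 (by norm_num) hM.1 h (by ring),
      Or.inl rfl⟩
  rcases le_total M (9 / 4) with h' | h'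
  · exact ⟨_, mem_of_segment (convex_convexHull ℝ _) h1 h2 (by norm_num) h h' (by ring),
      Or.inr (Or.inl rfl)⟩
  · exact ⟨_, mem_of_segment (convex_convexHull ℝ _) h2 h3 (by norm_num) h' hM.2 (by ring),
      Or.inr (Or.inr rfl)⟩

/-- Some point of the convex hull of the corner points is not above any load that is achievable with
uncoded placement. -/
theorem exists_mem_convexHull_le {N : ℕ} (hN : N = 2 ∨ N = 3) {demandLaw : PMF (Demands 2 N)}
    (hfull : ∀ d, demandLaw d ≠ 0) {M : ℝ} (hM : M ∈ Set.Icc ((N : ℝ) / 2) (N : ℝ)) :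
    ∃ r, (M, r) ∈ convexHull ℝ (cornerPoints N) ∧
      ∀ R, Achievable (UncodedPlacement 2 N) demandLaw M R → r ≤ R := by
  rcases hN with rfl | rfl
  · obtain ⟨r, hr, h⟩ := exists_mem_convexHull_two (M := M) (by norm_num at hM ⊢; exact hM)
    refine ⟨r, hr, fun R hR => ?_⟩
    have := converse_two_files hfull hR
    rcases h with rfl | rfl
    · exact this.1
    · exact this.2
  · obtain ⟨r, hr, h⟩ := exists_mem_convexHull_three (M := M) (by norm_num at hM ⊢; exact hM)
    refine ⟨r, hr, fun R hR => ?_⟩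
    have := converse_three_files hfull hR
    rcases h with rfl | rfl | rfl
    · exact this.1
    · exact this.2.1
    · exact this.2.2

end SchemeB

/-! ### Conclusion: both minima equal the envelope -/

theorem Achievable.mono {K N : ℕ} {𝒮 𝒯 : ∀ B : ℕ, CachingScheme K N B → Prop}
    {demandLaw : PMF (Demands K N)} {M R : ℝ} (h : Achievable 𝒮 demandLaw M R)
    (hle : ∀ B s, 𝒮 B s → 𝒯 B s) : Achievable 𝒯 demandLaw M R := by
  obtain ⟨ε, h0, hlim, hev⟩ := h
  exact ⟨ε, h0, hlim, hev.mono fun B ⟨s, hs, hv⟩ => ⟨s, hle B s hs, hv⟩⟩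

end

theorem corollary1 (N : ℕ) (hN : N = 2 ∨ N = 3)
    (demandLaw : PMF (Demands 2 N)) (hfull : ∀ d : Demands 2 N, demandLaw d ≠ 0)
    (M : ℝ) (hM : M ∈ Set.Icc ((N : ℝ) / 2) (N : ℝ)) :
    IsLeast {R : ℝ | Achievable (SchemeB.IsSchemeB N) demandLaw M R} (SchemeB.load N M) ∧
      IsLeast {R : ℝ | Achievable (UncodedPlacement 2 N) demandLaw M R} (SchemeB.load N M) := by
  obtain ⟨r, hr, hlow⟩ := SchemeB.exists_mem_convexHull_le hN hfull hM
  have hincl : ∀ R, Achievable (SchemeB.IsSchemeB N) demandLaw M R →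
      Achievable (UncodedPlacement 2 N) demandLaw M R :=
    fun R h => h.mono fun B s hs => hs.isUncoded
  have hach : ∀ R, (M, R) ∈ convexHull ℝ (SchemeB.cornerPoints N) →
      Achievable (SchemeB.IsSchemeB N) demandLaw M R :=
    fun R h => (SchemeB.isAchieved_of_mem_convexHull hN h).achievable demandLaw
  -- Every hull point above `M` is achieved by Scheme B, hence with uncoded placement, so the
  -- converse bound also makes `r` least in the hull.
  have hload : SchemeB.load N M = r :=
    IsLeast.csInf_eq ⟨hr, fun R hR => hlow R (hincl R (hach R hR))⟩
  rw [hload]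
  exact ⟨⟨hach r hr, fun R hR => hlow R (hincl R hR)⟩,
    ⟨hincl r (hach r hr), fun R hR => hlow R hR⟩⟩
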